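/- Let $L$ be the language of graphs, with one binary relation symbol $r$, and let $T$ be the theory of the random graph (simple graphs satisfying all the extension axioms). Let $L_0=L\cup\{f,f^{-1}\}$, with $f$ and $f^{-1}$ new unary function symbols, and let $T_0$ be the $L_0$-theory consisting of $T$, axioms saying that $f$ is an automorphism with inverse $f^{-1}$ (that is, $\forall x\, f(f^{-1}x)=x$, $\forall x\, f^{-1}(fx)=x$ and $\forall x\,\forall y\,(r(x,y)\leftrightarrow r(fx,fy))$), and, for every positive integer $n$, the axiom $\forall x\, f^n x\neq x$ (so $f$ has no finite cycles). For a countable model $N$ of $T$, let $\mathrm{Exp}(N,T_0)$ be the set of interpretations $\sigma$ of $f,f^{-1}$ in $N$ such that $(N,\sigma)\models T_0$, with the topology generated by the sets $\{\sigma : (N,\sigma)\models\varphi\}$, where $\varphi$ ranges over the quantifier-free $L_0$-sentences with parameters in $N$. For $g\in\mathrm{Aut}(N)$ let $\sigma^g$ be the unique expansion of $N$ that makes $g:(N,\sigma)\to(N,\sigma^g)$ an isomorphism. An expansion $\tau\in\mathrm{Exp}(N,T_0)$ is Truss generic if $\{\tau^g : g\in\mathrm{Aut}(N)\}$ is a comeagre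 subset of $\mathrm{Exp}(N,T_0)$. Then $T_0$ has a model companion, that is, there is an $L_0$-theory $T_{\mathrm{mc}}$ such that every model of $T_0$ embeds in a model of $T_{\mathrm{mc}}$, every model of $T_{\mathrm{mc}}$ embeds in a model of $T_0$, and every embedding between models of $T_{\mathrm{mc}}$ is elementary. Nevertheless, for every countable model $N$ of $T$, no expansion in $\mathrm{Exp}(N,T_0)$ is Truss generic. -/

import Mathlib

open FirstOrder FirstOrder.Language

/-! ### First-order expansions, their topology, and Truss genericity -/

section Expansions

/-- The expansions of the `L`-structure `N` to the signature `L.sum L'` (the disjoint union of `L`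
and of the new symbols `L'`): such an expansion is an interpretation in `N` of the symbols of `L'`.
-/
def Expansion (L L' : FirstOrder.Language) (N : Type*) [_base : L.Structure N] : Type _ :=
  L'.Structure N

variable {L L' : FirstOrder.Language} {N : Type*} [L.Structure N]

/-- The expanded structure `(N, σ)`. -/
@[reducible]
def Expansion.toStructure (σ : Expansion L L' N) : (L.sum L').Structure N :=
  letI : L'.Structure N := σ
  FirstOrder.Language.sumStructure L L' N

/-- `(N, σ) ⊨ φ`, where `φ` is a sentence with parameters in `N`: it is written as a formula whose
free variables are indexed by the elements of `N`, each of which is assigned to itself. -/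
def Expansion.Satisfies (σ : Expansion L L' N) (φ : (L.sum L').Formula N) : Prop :=
  letI : (L.sum L').Structure N := σ.toStructure
  φ.Realize id

/-- `(N, σ)` is a model of the theory `T₀`. -/
def Expansion.IsModel (σ : Expansion L L' N) (T₀ : (L.sum L').Theory) : Prop :=
  letI : (L.sum L').Structure N := σ.toStructure
  N ⊨ T₀

/-- The topology on the set of expansions of `N`, generated by the sets `{σ | (N, σ) ⊨ φ}`, with
`φ` a quantifier-free sentence with parameters in `N`. -/
instance Expansion.instTopologicalSpace : TopologicalSpace (Expansion L L' N) :=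
  TopologicalSpace.generateFrom
    {U | ∃ φ : (L.sum L').Formula N, φ.IsQF ∧ U = {σ : Expansion L L' N | σ.Satisfies φ}}

/-- For an automorphism `g` of the `L`-structure `N`, the expansion `σ^g`, which is the unique one
that makes `g` an isomorphism from `(N, σ)` to `(N, σ^g)`. -/
def Expansion.conj (σ : Expansion L L' N) (g : N ≃[L] N) : Expansion L L' N :=
  letI : L'.Structure N := σ
  (g.toEquiv.inducedStructure : L'.Structure N)

variable (N)

/-- `Exp(N, T₀)`: the expansions of `N` that are models of `T₀`. It is given the subspace
topology. -/
def Exp (T₀ : (L.sum L').Theory) : Set (Expansion L L' N) :=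
  {σ | σ.IsModel T₀}

variable {N}

/-- The expansion `τ` in `Exp(N, T₀)` is Truss generic if its conjugacy class
`{τ^g | g ∈ Aut(N)}` is a comeagre subset of `Exp(N, T₀)`. -/
def IsTrussGeneric {T₀ : (L.sum L').Theory} (τ : Exp N T₀) : Prop :=
  {σ : Exp N T₀ | ∃ g : N ≃[L] N, (σ : Expansion L L' N) = (τ : Expansion L L' N).conj g} ∈
    residual (Exp N T₀)

end Expansions

/-! ### Model companions -/

section ModelCompanion

universe u v

variable {L : FirstOrder.Language.{u, v}}

/-- A theory is model complete if every embedding between models of it is elementary. -/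
def IsModelComplete (T : L.Theory) : Prop :=
  ∀ (M M' : Theory.ModelType.{u, v, max u v} T) (h : M ↪[L] M') (n : ℕ) (φ : L.Formula (Fin n))
    (x : Fin n → M), φ.Realize (h ∘ x) ↔ φ.Realize x

/-- `T'` is a model companion of `T`: every model of `T` embeds in a model of `T'`, every model
of `T'` embeds in a model of `T`, and `T'` is model complete. -/
def IsModelCompanion (T T' : L.Theory) : Prop :=
  (∀ M : Theory.ModelType.{u, v, max u v} T, ∃ M' : Theory.ModelType.{u, v, max u v} T',
    Nonempty (M ↪[L] M')) ∧
  (∀ M' : Theory.ModelType.{u, v, max u v} T', ∃ M : Theory.ModelType.{u, v, max u v} T,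
    Nonempty (M' ↪[L] M)) ∧
  IsModelComplete T'

end ModelCompanion

/-! ### The random graph and its cycle-free automorphisms -/

section RandomGraph

/-- The extension axiom: for all `x₁, …, xₘ` and `y₁, …, yₙ` with `xᵢ ≠ yⱼ` for all `i, j`, there is
a vertex `z`, different from all of them, that is adjacent to every `xᵢ` and to no `yⱼ`. -/
noncomputable def extensionAxiom (m n : ℕ) : FirstOrder.Language.graph.Sentence :=
  Formula.iAlls (α := Empty) (Fin m ⊕ Fin n) <|
    Formula.imp
      (Formula.iInf fun p : Fin m × Fin n =>
        Formula.not (Term.equal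
          (Term.var (Sum.inr (Sum.inl p.1))) (Term.var (Sum.inr (Sum.inr p.2)))))
      (Formula.iExs Unit <|
        (Formula.iInf fun k : Fin m ⊕ Fin n =>
          Formula.not (Term.equal
            (Term.var (Sum.inr ())) (Term.var (Sum.inl (Sum.inr k))))) ⊓
        ((Formula.iInf fun i : Fin m =>
          Relations.formula₂ adj
            (Term.var (Sum.inr ())) (Term.var (Sum.inl (Sum.inr (Sum.inl i))))) ⊓
        (Formula.iInf fun j : Fin n =>
          Formula.not (Relations.formula₂ adj
            (Term.var (Sum.inr ())) (Term.var (Sum.inl (Sum.inr (Sum.inr j))))))))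

/-- The theory of the random graph: simple graphs satisfying all the extension axioms. -/
def randomGraphTheory : FirstOrder.Language.graph.Theory :=
  Theory.simpleGraph ∪ {φ | ∃ m n : ℕ, φ = extensionAxiom m n}

/-- The two new unary function symbols `f` and `f⁻¹`. -/
inductive AutFunctions : ℕ → Type
  | f : AutFunctions 1
  | fInv : AutFunctions 1

/-- The signature consisting of the two unary function symbols `f` and `f⁻¹`. -/
def autLanguage : FirstOrder.Language := ⟨AutFunctions, fun _ => Empty⟩

/-- The language of graphs enriched with `f` and `f⁻¹`. -/
abbrev graphAutLanguage : FirstOrder.Language := FirstOrder.Language.graph.sum autLanguage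

/-- The term `f t`. -/
def fTerm {α : Type} (t : graphAutLanguage.Term α) : graphAutLanguage.Term α :=
  Functions.apply₁ (Sum.inr AutFunctions.f : graphAutLanguage.Functions 1) t

/-- The term `f⁻¹ t`. -/
def fInvTerm {α : Type} (t : graphAutLanguage.Term α) : graphAutLanguage.Term α :=
  Functions.apply₁ (Sum.inr AutFunctions.fInv : graphAutLanguage.Functions 1) t

/-- The formula `r(s, t)`, where `r` is the adjacency relation. -/
def adjFormula {α : Type} (s t : graphAutLanguage.Term α) : graphAutLanguage.Formula α :=
  Relations.formula₂ (Sum.inl adj : graphAutLanguage.Relations 2) s t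

/-- `∀ x, f (f⁻¹ x) = x`. -/
noncomputable def rightInverseAxiom : graphAutLanguage.Sentence :=
  Formula.iAlls (α := Empty) (Fin 1) <|
    Term.equal (fTerm (fInvTerm (Term.var (Sum.inr 0)))) (Term.var (Sum.inr 0))

/-- `∀ x, f⁻¹ (f x) = x`. -/
noncomputable def leftInverseAxiom : graphAutLanguage.Sentence :=
  Formula.iAlls (α := Empty) (Fin 1) <|
    Term.equal (fInvTerm (fTerm (Term.var (Sum.inr 0)))) (Term.var (Sum.inr 0))

/-- `∀ x y, r(x, y) ↔ r(f x, f y)`. -/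
noncomputable def preservesAdjAxiom : graphAutLanguage.Sentence :=
  Formula.iAlls (α := Empty) (Fin 2) <|
    Formula.iff (adjFormula (Term.var (Sum.inr 0)) (Term.var (Sum.inr 1)))
      (adjFormula (fTerm (Term.var (Sum.inr 0))) (fTerm (Term.var (Sum.inr 1))))

/-- `∀ x, fⁿ x ≠ x`. -/
noncomputable def noCycleAxiom (n : ℕ) : graphAutLanguage.Sentence :=
  Formula.iAlls (α := Empty) (Fin 1) <|
    Formula.not (Term.equal (fTerm^[n] (Term.var (Sum.inr 0))) (Term.var (Sum.inr 0)))

/-- The theory of the random graph, together with the axioms saying that `f` is an automorphism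
with inverse `f⁻¹` and that `f` has no finite cycles. -/
def cycleFreeAutTheory : graphAutLanguage.Theory :=
  LHom.sumInl.onTheory randomGraphTheory ∪
    {rightInverseAxiom, leftInverseAxiom, preservesAdjAxiom} ∪
    {φ | ∃ n : ℕ, 0 < n ∧ φ = noCycleAxiom n}

end RandomGraph

/-! Model companion. Over a finite set of vertices, a point `z` outside their orbits is described,
up to quantifier-free formulas, by its adjacencies to those orbits and by the set of `k ≥ 1` with
`z` adjacent to `fᵏ z`; since `f` has no cycles, both can be prescribed freely. A single formula
sees only finitely many of these data, so "every finite prescription is realized" is a first-order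
scheme, `OrbitExtension`. It supports a back-and-forth argument with a shrinking window of exponents
(`exists_sameDiagram_extend`), so the truth of a formula at a tuple is decided by a finite part of
its diagram (`exists_forall_realize_iff`), and embeddings preserve diagrams. Conversely, any model
of the original theory sits inside a hull to which free orbits have been added for all finite
prescriptions (`OrbitHull.orbitExtension`).

No Truss generic. The set of all `n` with `fⁿ z` adjacent to `z` is an invariant of the pair `(f,
z)` under conjugation. A finite part of `f` decides only finitely much of it, so for any fixed set
`S` a generic `f` has no orbit with invariant `S` (`isCofinal_orbit_ne`). Given `τ`, only countably
many sets occur as its invariants. If the conjugacy class of `τ` were comeagre, a sufficiently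
generic `F` would lie in it and yet share no invariant with it. Genericity is obtained by building
`F` from finite acyclic partial automorphisms (`exists_perm_extends`), which `isCofinal_of_dense`
links to the dense open sets. -/

/-! ### Semantic descriptions of the theories -/

section Semantics

open Structure

/-- A symmetric irreflexive relation with all the extension properties of the random graph. -/
structure IsRandomGraph {M : Type*} (A : M → M → Prop) : Prop where
  irrefl : ∀ x, ¬ A x x
  symm : ∀ x y, A x y → A y x
  ext : ∀ X Y : Finset M, Disjoint X Y →
    ∃ z, z ∉ X ∧ z ∉ Y ∧ (∀ x ∈ X, A z x) ∧ ∀ y ∈ Y, ¬ A z y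

theorem exists_range_eq_finset {M : Type*} (X : Finset M) :
    ∃ (n : ℕ) (x : Fin n → M), Set.range x = (X : Set M) :=
  ⟨X.card, fun i => X.equivFin.symm i, by
    ext a
    constructor
    · rintro ⟨i, rfl⟩
      exact (X.equivFin.symm i).2
    · intro ha
      exact ⟨X.equivFin ⟨a, ha⟩, by simp⟩⟩

theorem model_randomGraphTheory_iff {M : Type*} [Language.graph.Structure M] :
    M ⊨ randomGraphTheory ↔ IsRandomGraph (fun x y : M => RelMap adj ![x, y]) := by
  have hext : ∀ m n : ℕ, M ⊨ extensionAxiom m n ↔ ∀ v : Fin m ⊕ Fin n → M,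
      (∀ i j, v (Sum.inl i) ≠ v (Sum.inr j)) → ∃ z : M, (∀ k, z ≠ v k) ∧
        (∀ i, RelMap adj ![z, v (Sum.inl i)]) ∧ ∀ j, ¬ RelMap adj ![z, v (Sum.inr j)] := by
    intro m n
    simp only [extensionAxiom, Sentence.Realize, Formula.realize_iAlls, Formula.realize_imp,
      Formula.realize_iInf, Formula.realize_not, Formula.realize_equal, Formula.realize_iExs,
      Formula.realize_inf, Formula.realize_rel₂, Term.realize_var, Sum.elim_inl, Sum.elim_inr,
      Prod.forall]
    refine forall_congr' fun v => imp_congr Iff.rfl ?_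
    exact ⟨fun ⟨i, h⟩ => ⟨i (), h⟩, fun ⟨z, h⟩ => ⟨fun _ => z, h⟩⟩
  rw [randomGraphTheory, Theory.model_union_iff, Theory.simpleGraph_model_iff, Theory.model_iff]
  constructor
  · rintro ⟨⟨h1, h2⟩, h3⟩
    refine ⟨h1.irrefl, fun x y => h2.symm x y, fun X Y hXY => ?_⟩
    obtain ⟨m, x, hx⟩ := exists_range_eq_finset X
    obtain ⟨n, y, hy⟩ := exists_range_eq_finset Y
    have hX : ∀ a, a ∈ X ↔ ∃ i, x i = a := fun a => by
      rw [← Finset.mem_coe, ← hx, Set.mem_range]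
    have hY : ∀ a, a ∈ Y ↔ ∃ i, y i = a := fun a => by
      rw [← Finset.mem_coe, ← hy, Set.mem_range]
    obtain ⟨z, hz, hz1, hz2⟩ := (hext m n).1 (h3 _ ⟨m, n, rfl⟩) (Sum.elim x y)
      fun i j h => Finset.disjoint_left.1 hXY ((hX _).2 ⟨i, rfl⟩) ((hY _).2 ⟨j, h.symm⟩)
    refine ⟨z, fun h => ?_, fun h => ?_, fun a h => ?_, fun a h => ?_⟩
    · obtain ⟨i, hi⟩ := (hX _).1 h
      exact hz (Sum.inl i) hi.symm
    · obtain ⟨i, hi⟩ := (hY _).1 h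
      exact hz (Sum.inr i) hi.symm
    · obtain ⟨i, rfl⟩ := (hX _).1 h
      exact hz1 i
    · obtain ⟨i, rfl⟩ := (hY _).1 h
      exact hz2 i
  · intro h
    refine ⟨⟨⟨h.irrefl⟩, ⟨h.symm⟩⟩, ?_⟩
    rintro φ ⟨m, n, rfl⟩
    classical
    refine (hext m n).2 fun v hv => ?_
    obtain ⟨z, hz1, hz2, hz3, hz4⟩ := h.ext (Finset.univ.image (v ∘ Sum.inl))
      (Finset.univ.image (v ∘ Sum.inr)) (by
        rw [Finset.disjoint_left]
        intro a ha hb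
        simp only [Finset.mem_image, Finset.mem_univ, true_and] at ha hb
        obtain ⟨i, rfl⟩ := ha
        obtain ⟨j, hj⟩ := hb
        exact hv i j hj.symm)
    refine ⟨z, ?_, fun i => hz3 _ (by simp), fun j => hz4 _ (by simp)⟩
    rintro (i | j) rfl
    · exact hz1 (by simp)
    · exact hz2 (by simp)

variable {M : Type*} [graphAutLanguage.Structure M]

/-- Adjacency in a structure for the language of graphs with an automorphism. -/
def autAdj (x y : M) : Prop := RelMap (L := graphAutLanguage) (Sum.inl adj) ![x, y]

/-- The interpretation of `f`. -/
def autMap (x : M) : M := funMap (L := graphAutLanguage) (Sum.inr AutFunctions.f) ![x]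

/-- The interpretation of `f⁻¹`. -/
def autInv (x : M) : M := funMap (L := graphAutLanguage) (Sum.inr AutFunctions.fInv) ![x]

theorem realize_fTerm {α : Type} (t : graphAutLanguage.Term α) (v : α → M) :
    (fTerm t).realize v = autMap (t.realize v) :=
  Term.realize_functions_apply₁

theorem realize_fInvTerm {α : Type} (t : graphAutLanguage.Term α) (v : α → M) :
    (fInvTerm t).realize v = autInv (t.realize v) :=
  Term.realize_functions_apply₁

theorem realize_adjFormula {α : Type} (s t : graphAutLanguage.Term α) (v : α → M) :
    (adjFormula s t).Realize v ↔ autAdj (s.realize v) (t.realize v) :=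
  Formula.realize_rel₂

theorem realize_fTerm_iterate {α : Type} (n : ℕ) (t : graphAutLanguage.Term α) (v : α → M) :
    (fTerm^[n] t).realize v = autMap^[n] (t.realize v) := by
  induction n with
  | zero => rfl
  | succ n ih => rw [Function.iterate_succ_apply', Function.iterate_succ_apply', realize_fTerm, ih]

theorem realize_rightInverseAxiom :
    M ⊨ rightInverseAxiom ↔ ∀ x : M, autMap (autInv x) = x := by
  simp only [rightInverseAxiom, Sentence.Realize, Formula.realize_iAlls, Formula.realize_equal,
    realize_fTerm, realize_fInvTerm, Term.realize_var, Sum.elim_inr]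
  exact ⟨fun h x => h fun _ => x, fun h x => h _⟩

theorem realize_leftInverseAxiom :
    M ⊨ leftInverseAxiom ↔ ∀ x : M, autInv (autMap x) = x := by
  simp only [leftInverseAxiom, Sentence.Realize, Formula.realize_iAlls, Formula.realize_equal,
    realize_fTerm, realize_fInvTerm, Term.realize_var, Sum.elim_inr]
  exact ⟨fun h x => h fun _ => x, fun h x => h _⟩

theorem realize_preservesAdjAxiom :
    M ⊨ preservesAdjAxiom ↔ ∀ x y : M, autAdj x y ↔ autAdj (autMap x) (autMap y) := by
  simp only [preservesAdjAxiom, Sentence.Realize, Formula.realize_iAlls, Formula.realize_iff,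
    realize_adjFormula, realize_fTerm, Term.realize_var, Sum.elim_inr]
  exact ⟨fun h x y => h ![x, y], fun h x => h _ _⟩

theorem realize_noCycleAxiom (n : ℕ) :
    M ⊨ noCycleAxiom n ↔ ∀ x : M, autMap^[n] x ≠ x := by
  simp only [noCycleAxiom, Sentence.Realize, Formula.realize_iAlls, Formula.realize_not,
    Formula.realize_equal, realize_fTerm_iterate, Term.realize_var, Sum.elim_inr]
  exact ⟨fun h x => h fun _ => x, fun h x => h _⟩

/-- `f` is an automorphism of the graph with inverse `f⁻¹` and without finite cycles. -/
structure IsCycleFreeAut (M : Type*) [graphAutLanguage.Structure M] : Prop where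
  right_inv : ∀ x : M, autMap (autInv x) = x
  left_inv : ∀ x : M, autInv (autMap x) = x
  map_adj : ∀ x y : M, autAdj x y ↔ autAdj (autMap x) (autMap y)
  iterate_ne : ∀ n, 0 < n → ∀ x : M, autMap^[n] x ≠ x

theorem model_cycleFreeAutTheory_iff :
    M ⊨ cycleFreeAutTheory ↔ IsRandomGraph (autAdj (M := M)) ∧ IsCycleFreeAut M := by
  let : Language.graph.Structure M :=
    (LHom.sumInl : Language.graph →ᴸ graphAutLanguage).reduct M
  have hT : M ⊨ cycleFreeAutTheory ↔ M ⊨ randomGraphTheory ∧ M ⊨ rightInverseAxiom ∧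
      M ⊨ leftInverseAxiom ∧ M ⊨ preservesAdjAxiom ∧ ∀ n : ℕ, 0 < n → M ⊨ noCycleAxiom n := by
    rw [cycleFreeAutTheory, Theory.model_union_iff, Theory.model_union_iff, LHom.onTheory_model]
    simp only [Theory.model_iff, Set.mem_insert_iff, Set.mem_singleton_iff, forall_eq_or_imp,
      forall_eq, Set.mem_ofPred_eq]
    constructor
    · rintro ⟨⟨h1, h2, h3, h4⟩, h5⟩
      exact ⟨h1, h2, h3, h4, fun n hn => h5 _ ⟨n, hn, rfl⟩⟩
    · rintro ⟨h1, h2, h3, h4, h5⟩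
      refine ⟨⟨h1, h2, h3, h4⟩, ?_⟩
      rintro φ ⟨n, hn, rfl⟩
      exact h5 n hn
  rw [hT, model_randomGraphTheory_iff]
  simp only [realize_rightInverseAxiom, realize_leftInverseAxiom, realize_preservesAdjAxiom,
    realize_noCycleAxiom]
  exact and_congr Iff.rfl ⟨fun ⟨h1, h2, h3, h4⟩ => ⟨h1, h2, h3, h4⟩,
    fun ⟨h1, h2, h3, h4⟩ => ⟨h1, h2, h3, h4⟩⟩

/-- For all `x₁, …, xₘ` and `y₁, …, yₙ` with `xᵢ ≠ yⱼ` for all `i, j`, there is a vertex `z`,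
different from all of them, that is adjacent to every `xᵢ` and to no `yⱼ`, and that for
`1 ≤ k ≤ K` is adjacent to `fᵏ z` if and only if `k ∈ P`. -/
noncomputable def orbitExtensionAxiom (m n K : ℕ) (P : Finset ℕ) : graphAutLanguage.Sentence :=
  Formula.iAlls (α := Empty) (Fin m ⊕ Fin n) <|
    Formula.imp
      (Formula.iInf fun p : Fin m × Fin n =>
        Formula.not (Term.equal
          (Term.var (Sum.inr (Sum.inl p.1))) (Term.var (Sum.inr (Sum.inr p.2)))))
      (Formula.iExs Unit <|
        (Formula.iInf fun k : Fin m ⊕ Fin n =>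
          Formula.not (Term.equal
            (Term.var (Sum.inr ())) (Term.var (Sum.inl (Sum.inr k))))) ⊓
        ((Formula.iInf fun i : Fin m =>
          adjFormula (Term.var (Sum.inr ())) (Term.var (Sum.inl (Sum.inr (Sum.inl i))))) ⊓
        ((Formula.iInf fun j : Fin n =>
          Formula.not
            (adjFormula (Term.var (Sum.inr ())) (Term.var (Sum.inl (Sum.inr (Sum.inr j)))))) ⊓
        (Formula.iInf fun k : Fin K =>
          Formula.iff
            (adjFormula (Term.var (Sum.inr ())) (fTerm^[(k : ℕ) + 1] (Term.var (Sum.inr ()))))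
            (if (k : ℕ) + 1 ∈ P then ⊤ else ⊥)))))

/-- The extension property of the generic cycle-free automorphisms. -/
def OrbitExtension {M : Type*} (A : M → M → Prop) (f : M → M) : Prop :=
  ∀ (X Y : Finset M) (K : ℕ) (P : Finset ℕ), Disjoint X Y →
    ∃ z, z ∉ X ∧ z ∉ Y ∧ (∀ x ∈ X, A z x) ∧ (∀ y ∈ Y, ¬ A z y) ∧
      ∀ k, 1 ≤ k → k ≤ K → (A z (f^[k] z) ↔ k ∈ P)

theorem realize_orbitExtensionAxiom (m n K : ℕ) (P : Finset ℕ) :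
    M ⊨ orbitExtensionAxiom m n K P ↔ ∀ v : Fin m ⊕ Fin n → M,
      (∀ i j, v (Sum.inl i) ≠ v (Sum.inr j)) → ∃ z : M, (∀ k, z ≠ v k) ∧
        (∀ i, autAdj z (v (Sum.inl i))) ∧ (∀ j, ¬ autAdj z (v (Sum.inr j))) ∧
        ∀ k : Fin K, autAdj z (autMap^[(k : ℕ) + 1] z) ↔ (k : ℕ) + 1 ∈ P := by
  -- Membership in `P` is decided outside the language, so it enters the axiom as the constant `⊤`
  -- or `⊥`.
  have hite : ∀ (p : Prop) [Decidable p] {β : Type} (v : β → M),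
      (if p then ⊤ else ⊥ : graphAutLanguage.Formula β).Realize v ↔ p := by
    intro p _ β v
    split_ifs with h
    · exact iff_of_true (Formula.realize_top.2 trivial) h
    · exact iff_of_false Formula.realize_bot.1 h
  simp only [orbitExtensionAxiom, Sentence.Realize, Formula.realize_iAlls, Formula.realize_imp,
    Formula.realize_iInf, Formula.realize_not, Formula.realize_equal, Formula.realize_iExs,
    Formula.realize_inf, realize_adjFormula, Term.realize_var, Sum.elim_inl, Sum.elim_inr,
    Prod.forall, Formula.realize_iff, realize_fTerm_iterate, hite]
  refine forall_congr' fun v => imp_congr Iff.rfl ?_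
  exact ⟨fun ⟨i, h⟩ => ⟨i (), h⟩, fun ⟨z, h⟩ => ⟨fun _ => z, h⟩⟩

theorem forall_realize_orbitExtensionAxiom_iff :
    (∀ m n K P, M ⊨ orbitExtensionAxiom m n K P) ↔
      OrbitExtension (autAdj (M := M)) autMap := by
  simp only [realize_orbitExtensionAxiom]
  constructor
  · intro h X Y K P hXY
    obtain ⟨m, x, hx⟩ := exists_range_eq_finset X
    obtain ⟨n, y, hy⟩ := exists_range_eq_finset Y
    have hX : ∀ a, a ∈ X ↔ ∃ i, x i = a := fun a => by
      rw [← Finset.mem_coe, ← hx, Set.mem_range]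
    have hY : ∀ a, a ∈ Y ↔ ∃ i, y i = a := fun a => by
      rw [← Finset.mem_coe, ← hy, Set.mem_range]
    obtain ⟨z, hz, hz1, hz2, hz3⟩ := h m n K P (Sum.elim x y)
      fun i j h => Finset.disjoint_left.1 hXY ((hX _).2 ⟨i, rfl⟩) ((hY _).2 ⟨j, h.symm⟩)
    refine ⟨z, fun h => ?_, fun h => ?_, fun a h => ?_, fun a h => ?_, fun k h1 hK => ?_⟩
    · obtain ⟨i, hi⟩ := (hX _).1 h
      exact hz (Sum.inl i) hi.symm
    · obtain ⟨i, hi⟩ := (hY _).1 h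
      exact hz (Sum.inr i) hi.symm
    · obtain ⟨i, rfl⟩ := (hX _).1 h
      exact hz1 i
    · obtain ⟨i, rfl⟩ := (hY _).1 h
      exact hz2 i
    · obtain ⟨l, rfl⟩ : ∃ l, k = l + 1 := ⟨k - 1, by omega⟩
      exact hz3 ⟨l, by omega⟩
  · intro h m n K P v hv
    classical
    obtain ⟨z, hz1, hz2, hz3, hz4, hz5⟩ := h (Finset.univ.image (v ∘ Sum.inl))
      (Finset.univ.image (v ∘ Sum.inr)) K P (by
        rw [Finset.disjoint_left]
        intro a ha hb
        simp only [Finset.mem_image, Finset.mem_univ, true_and] at ha hb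
        obtain ⟨i, rfl⟩ := ha
        obtain ⟨j, hj⟩ := hb
        exact hv i j hj.symm)
    refine ⟨z, ?_, fun i => hz3 _ (by simp), fun j => hz4 _ (by simp),
      fun k => hz5 _ (by omega) (by omega)⟩
    rintro (i | j) rfl
    · exact hz1 (by simp)
    · exact hz2 (by simp)

/-- The model companion of `cycleFreeAutTheory`. -/
noncomputable def genericAutTheory : graphAutLanguage.Theory :=
  cycleFreeAutTheory ∪ {φ | ∃ m n K P, φ = orbitExtensionAxiom m n K P}

theorem model_genericAutTheory_iff :
    M ⊨ genericAutTheory ↔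
      M ⊨ cycleFreeAutTheory ∧ OrbitExtension (autAdj (M := M)) autMap := by
  rw [genericAutTheory, Theory.model_union_iff, ← forall_realize_orbitExtensionAxiom_iff]
  refine and_congr Iff.rfl ?_
  rw [Theory.model_iff]
  constructor
  · exact fun h m n K P => h _ ⟨m, n, K, P, rfl⟩
  · rintro h φ ⟨m, n, K, P, rfl⟩
    exact h m n K P

/-- The automorphism `f` as a permutation. -/
def IsCycleFreeAut.perm (h : IsCycleFreeAut M) : Equiv.Perm M :=
  ⟨autMap, autInv, h.left_inv, h.right_inv⟩

end Semantics

/-! ### Model completeness -/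

section ModelCompleteness

open Structure

/-- A cycle-free automorphism `F` of a graph `A` with the orbit extension property. -/
structure IsGenericAut {M : Type*} (A : M → M → Prop) (F : Equiv.Perm M) : Prop where
  irrefl : ∀ x, ¬ A x x
  symm : ∀ x y, A x y → A y x
  map_adj : ∀ x y, A x y ↔ A (F x) (F y)
  zpow_ne : ∀ k : ℤ, k ≠ 0 → ∀ x, (F ^ k) x ≠ x
  ext : OrbitExtension A F

/-- The tuples `a` and `b` satisfy the same formulas `fᵏ xᵢ = xⱼ` and `r(fᵏ xᵢ, xⱼ)`
for `|k| ≤ K`. -/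
def SameDiagram {M M' ι : Type*} (A : M → M → Prop) (F : Equiv.Perm M) (A' : M' → M' → Prop)
    (F' : Equiv.Perm M') (K : ℕ) (a : ι → M) (b : ι → M') : Prop :=
  ∀ (i j : ι) (k : ℤ), |k| ≤ K →
    ((F ^ k) (a i) = a j ↔ (F' ^ k) (b i) = b j) ∧
      (A ((F ^ k) (a i)) (a j) ↔ A' ((F' ^ k) (b i)) (b j))

namespace IsGenericAut

variable {M : Type*} {A : M → M → Prop} {F : Equiv.Perm M}

theorem adj_comm (h : IsGenericAut A F) (x y : M) : A x y ↔ A y x := ⟨h.symm x y, h.symm y x⟩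

theorem adj_zpow_iff (h : IsGenericAut A F) (k : ℤ) : ∀ x y, A ((F ^ k) x) ((F ^ k) y) ↔ A x y := by
  induction k using Int.induction_on with
  | zero => intro x y; rfl
  | succ n ih =>
    intro x y
    rw [zpow_add_one, Equiv.Perm.mul_apply, Equiv.Perm.mul_apply, ih, ← h.map_adj]
  | pred n ih =>
    intro x y
    rw [zpow_sub_one, Equiv.Perm.mul_apply, Equiv.Perm.mul_apply, ih, h.map_adj]
    simp

theorem adj_zpow_left (h : IsGenericAut A F) (k : ℤ) (x y : M) :
    A ((F ^ k) x) y ↔ A x ((F ^ (-k)) y) := by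
  rw [← h.adj_zpow_iff (-k), ← Equiv.Perm.mul_apply, ← zpow_add]
  simp

theorem zpow_apply_eq_zpow_apply (F : Equiv.Perm M) (k l : ℤ) (x y : M) :
    (F ^ k) x = (F ^ l) y ↔ (F ^ (k - l)) x = y := by
  rw [← (F ^ l).injective.eq_iff (a := (F ^ (k - l)) x), ← Equiv.Perm.mul_apply, ← zpow_add]
  simp

theorem adj_zpow_zpow (h : IsGenericAut A F) (k l : ℤ) (x y : M) :
    A ((F ^ k) x) ((F ^ l) y) ↔ A ((F ^ (k - l)) x) y := by
  rw [← h.adj_zpow_iff l ((F ^ (k - l)) x), ← Equiv.Perm.mul_apply, ← zpow_add]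
  simp

end IsGenericAut

variable {M M' ι : Type*} {A : M → M → Prop} {F : Equiv.Perm M} {A' : M' → M' → Prop}
  {F' : Equiv.Perm M'}

theorem SameDiagram.symm {K : ℕ} {a : ι → M} {b : ι → M'} (h : SameDiagram A F A' F' K a b) :
    SameDiagram A' F' A F K b a :=
  fun i j k hk => ⟨(h i j k hk).1.symm, (h i j k hk).2.symm⟩

theorem SameDiagram.mono {K K' : ℕ} {a : ι → M} {b : ι → M'} (h : SameDiagram A F A' F' K' a b)
    (hK : K ≤ K') : SameDiagram A F A' F' K a b :=
  fun i j k hk => h i j k (hk.trans (by exact_mod_cast hK))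

theorem SameDiagram.comp {κ : Type*} {K : ℕ} {a : ι → M} {b : ι → M'}
    (h : SameDiagram A F A' F' K a b) (e : κ → ι) : SameDiagram A F A' F' K (a ∘ e) (b ∘ e) :=
  fun i j k hk => h (e i) (e j) k hk

/-- The element `o.elim c a` of an extended tuple, when `c` is in the orbit of `a i₀`. -/
theorem elim_zpow_eq (F : Equiv.Perm M) (a : ι → M) (k₀ : ℤ) (i₀ : ι) (o : Option ι) :
    o.elim ((F ^ k₀) (a i₀)) a = (F ^ (o.elim k₀ fun _ => 0)) (a (o.elim i₀ id)) := by
  cases o <;> simp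

/-- This is the back-and-forth step. Comparing two translates by at most `K` at distance at most `K`
costs `3 * K`, whence the loss in the window. -/
theorem exists_sameDiagram_extend [Finite ι] (h : IsGenericAut A F) (h' : IsGenericAut A' F')
    {K : ℕ} {a : ι → M} {b : ι → M'} (hab : SameDiagram A F A' F' (3 * K) a b) (c : M) :
    ∃ d : M', SameDiagram A F A' F' K (fun o : Option ι => o.elim c a) (fun o => o.elim d b) := by
  classical
  -- If `c` is a translate of some `a i₀` within the window, the same translate of `b i₀` is forced.
  -- A translate farther away is invisible at level `K` and counts as a new point.
  by_cases hc : ∃ (i₀ : ι) (k₀ : ℤ), |k₀| ≤ K ∧ (F ^ k₀) (a i₀) = c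
  · obtain ⟨i₀, k₀, hk₀, rfl⟩ := hc
    refine ⟨(F' ^ k₀) (b i₀), fun i j k hk => ?_⟩
    simp only [elim_zpow_eq, ← Equiv.Perm.mul_apply, ← zpow_add]
    rw [IsGenericAut.zpow_apply_eq_zpow_apply, IsGenericAut.zpow_apply_eq_zpow_apply,
      h.adj_zpow_zpow, h'.adj_zpow_zpow]
    refine hab _ _ _ ?_
    rw [abs_le] at *
    push_cast
    cases i <;> cases j <;> simp <;> omega
  push Not at hc
  cases nonempty_fintype ι
  let I : Finset ℤ := Finset.Icc (-(K : ℤ)) K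
  have hI : ∀ k : ℤ, k ∈ I ↔ |k| ≤ K := fun k => by rw [Finset.mem_Icc, abs_le]
  let S : Finset (ι × ℤ) := Finset.univ ×ˢ I
  have hS : ∀ (p : ι × ℤ), p ∈ S ↔ |p.2| ≤ K := fun p => by
    rw [Finset.mem_product, hI]; simp
  -- The two prescribed sets are images of the windows around the `b i`. They are disjoint because
  -- coincidences between translates involve exponents at most `2 * K`, which `hab` transfers back
  -- to the `a i`. Together they contain all translates in the window, so `d` avoids these too.
  obtain ⟨d, hdX, hdY, hX, hY, hP⟩ := h'.ext
    ((S.filter fun p => A c ((F ^ p.2) (a p.1))).image fun p => (F' ^ p.2) (b p.1))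
    ((S.filter fun p => ¬ A c ((F ^ p.2) (a p.1))).image fun p => (F' ^ p.2) (b p.1))
    K ((Finset.Icc 1 K).filter fun k => A c ((F ^ k) c)) (by
      rw [Finset.disjoint_left]
      rintro x hx hy
      simp only [Finset.mem_image, Finset.mem_filter, hS] at hx hy
      obtain ⟨p, ⟨hp, hpc⟩, rfl⟩ := hx
      obtain ⟨q, ⟨hq, hqc⟩, hpq⟩ := hy
      refine hqc ?_
      rw [IsGenericAut.zpow_apply_eq_zpow_apply] at hpq
      have := (hab q.1 p.1 (q.2 - p.2) (by
        rw [abs_le] at *; push_cast; constructor <;> omega)).1.2 hpq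
      rw [← IsGenericAut.zpow_apply_eq_zpow_apply] at this
      rwa [this])
  have hd : ∀ i k, |k| ≤ (K : ℤ) → (F' ^ k) (b i) ≠ d := by
    rintro i k hk rfl
    by_cases hA : A c ((F ^ k) (a i))
    · exact hdX (Finset.mem_image_of_mem (fun p : ι × ℤ => (F' ^ p.2) (b p.1))
        (Finset.mem_filter.2 ⟨(hS (i, k)).2 hk, hA⟩))
    · exact hdY (Finset.mem_image_of_mem (fun p : ι × ℤ => (F' ^ p.2) (b p.1))
        (Finset.mem_filter.2 ⟨(hS (i, k)).2 hk, hA⟩))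
  have hdA : ∀ i k, |k| ≤ (K : ℤ) → (A c ((F ^ k) (a i)) ↔ A' d ((F' ^ k) (b i))) := by
    intro i k hk
    by_cases hA : A c ((F ^ k) (a i))
    · exact iff_of_true hA (hX _ (Finset.mem_image_of_mem (fun p : ι × ℤ => (F' ^ p.2) (b p.1))
        (Finset.mem_filter.2 ⟨(hS (i, k)).2 hk, hA⟩)))
    · exact iff_of_false hA (hY _ (Finset.mem_image_of_mem (fun p : ι × ℤ => (F' ^ p.2) (b p.1))
        (Finset.mem_filter.2 ⟨(hS (i, k)).2 hk, hA⟩)))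
  have hpos : ∀ k : ℕ, k ≤ K → (A c ((F ^ (k : ℤ)) c) ↔ A' d ((F' ^ (k : ℤ)) d)) := by
    intro k hk
    rcases Nat.eq_zero_or_pos k with rfl | hk0
    · exact iff_of_false (h.irrefl _) (h'.irrefl _)
    · have := hP k hk0 hk
      rw [Equiv.Perm.iterate_eq_pow, Finset.mem_filter, Finset.mem_Icc] at this
      rw [zpow_natCast, zpow_natCast, this]
      simp [hk, Nat.one_le_iff_ne_zero.2 hk0.ne']
  refine ⟨d, fun i j k hk => ?_⟩
  have hk' : |(-k)| ≤ (K : ℤ) := by rwa [abs_neg]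
  match i, j with
  | none, none =>
    simp only [Option.elim_none]
    constructor
    · rcases eq_or_ne k 0 with rfl | hk0
      · simp
      · exact iff_of_false (h.zpow_ne _ hk0 _) (h'.zpow_ne _ hk0 _)
    · rcases le_total 0 k with h0 | h0
      · lift k to ℕ using h0
        rw [h.adj_comm, h'.adj_comm]
        exact hpos k (by rw [abs_le] at hk; omega)
      · rw [h.adj_zpow_left, h'.adj_zpow_left]
        obtain ⟨l, rfl⟩ : ∃ l : ℕ, k = -l := ⟨k.natAbs, by omega⟩
        rw [neg_neg]
        exact hpos l (by rw [abs_le] at hk; omega)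
  | none, some j =>
    simp only [Option.elim_none, Option.elim_some]
    refine ⟨iff_of_false (fun e => hc j (-k) hk' ?_) (fun e => hd j (-k) hk' ?_), ?_⟩
    · rw [← e, ← Equiv.Perm.mul_apply, ← zpow_add]; simp
    · rw [← e, ← Equiv.Perm.mul_apply, ← zpow_add]; simp
    · rw [h.adj_zpow_left, h'.adj_zpow_left]
      exact hdA j (-k) hk'
  | some i, none =>
    simp only [Option.elim_none, Option.elim_some]
    refine ⟨iff_of_false (hc i k hk) (hd i k hk), ?_⟩
    rw [h.adj_comm, h'.adj_comm]
    exact hdA i k hk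
  | some i, some j =>
    exact hab i j k (hk.trans (by push_cast; omega))

theorem IsCycleFreeAut.isGenericAut {M : Type*} [graphAutLanguage.Structure M]
    (hF : IsCycleFreeAut M) (hA : IsRandomGraph (autAdj (M := M)))
    (hE : OrbitExtension (autAdj (M := M)) autMap) : IsGenericAut (autAdj (M := M)) hF.perm where
  irrefl := hA.irrefl
  symm := hA.symm
  map_adj := hF.map_adj
  zpow_ne := by
    have hn : ∀ n : ℕ, 0 < n → ∀ x, (hF.perm ^ n) x ≠ x := fun n hn x => by
      rw [← Equiv.Perm.iterate_eq_pow]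
      exact hF.iterate_ne n hn x
    intro k hk x
    rcases lt_or_gt_of_ne hk with h | h
    · obtain ⟨l, rfl⟩ : ∃ l : ℕ, k = -l := ⟨k.natAbs, by omega⟩
      rw [zpow_neg, zpow_natCast]
      intro e
      rw [Equiv.Perm.inv_eq_iff_eq] at e
      exact hn l (by omega) x e.symm
    · lift k to ℕ using h.le
      rw [zpow_natCast]
      exact hn k (by omega) x
  ext := hE

/-- The variable and the exponent depend on the term alone, which makes the bound `K` below uniform
over all models. -/
theorem exists_realize_eq_zpow {α : Type} (t : graphAutLanguage.Term α) :
    ∃ (i : α) (k : ℤ), ∀ (M : Type) [graphAutLanguage.Structure M] (hF : IsCycleFreeAut M)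
      (v : α → M), t.realize v = (hF.perm ^ k) (v i) := by
  induction t with
  | var i => exact ⟨i, 0, fun M _ hF v => rfl⟩
  | @func l g ts ih =>
    rcases g with g | g
    · exact g.elim
    · cases g with
      | f =>
        obtain ⟨i, k, h⟩ := ih 0
        refine ⟨i, 1 + k, fun M _ hF v => ?_⟩
        rw [zpow_add, Equiv.Perm.mul_apply, ← h M hF v, zpow_one]
        refine congrArg (funMap _) (funext fun j => ?_)
        rw [Subsingleton.elim j 0]; rfl
      | fInv =>
        obtain ⟨i, k, h⟩ := ih 0
        refine ⟨i, -1 + k, fun M _ hF v => ?_⟩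
        rw [zpow_add, Equiv.Perm.mul_apply, ← h M hF v, zpow_neg_one]
        refine congrArg (funMap _) (funext fun j => ?_)
        rw [Subsingleton.elim j 0]; rfl

/-- In models of `genericAutTheory`, the truth of a formula depends on finitely many atomic
formulas only. -/
theorem exists_forall_realize_iff {n l : ℕ} (φ : graphAutLanguage.BoundedFormula (Fin n) l) :
    ∃ K : ℕ, ∀ (M M' : Type) [graphAutLanguage.Structure M] [graphAutLanguage.Structure M']
      (hF : IsCycleFreeAut M) (hF' : IsCycleFreeAut M'),
      IsGenericAut (autAdj (M := M)) hF.perm → IsGenericAut (autAdj (M := M')) hF'.perm →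
      ∀ (v : Fin n → M) (xs : Fin l → M) (v' : Fin n → M') (xs' : Fin l → M'),
        SameDiagram (autAdj (M := M)) hF.perm (autAdj (M := M')) hF'.perm K
          (Sum.elim v xs) (Sum.elim v' xs') → (φ.Realize v xs ↔ φ.Realize v' xs') := by
  induction φ with
  | falsum => exact ⟨0, fun M M' _ _ _ _ _ _ v xs v' xs' _ => Iff.rfl⟩
  | equal t₁ t₂ =>
    obtain ⟨i₁, k₁, h₁⟩ := exists_realize_eq_zpow t₁
    obtain ⟨i₂, k₂, h₂⟩ := exists_realize_eq_zpow t₂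
    refine ⟨(k₁ - k₂).natAbs, fun M M' _ _ hF hF' _ _ v xs v' xs' hd => ?_⟩
    change t₁.realize _ = t₂.realize _ ↔ t₁.realize _ = t₂.realize _
    rw [h₁ M hF, h₂ M hF, h₁ M' hF', h₂ M' hF', IsGenericAut.zpow_apply_eq_zpow_apply,
      IsGenericAut.zpow_apply_eq_zpow_apply]
    exact (hd _ _ _ (by simp)).1
  | @rel l m R ts =>
    rcases R with R | R
    · cases R
      obtain ⟨i₁, k₁, h₁⟩ := exists_realize_eq_zpow (ts 0)
      obtain ⟨i₂, k₂, h₂⟩ := exists_realize_eq_zpow (ts 1)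
      refine ⟨(k₁ - k₂).natAbs, fun M M' _ _ hF hF' hM hM' v xs v' xs' hd => ?_⟩
      have key : ∀ (N : Type) [graphAutLanguage.Structure N] (w : Fin n ⊕ Fin l → N),
          RelMap (L := graphAutLanguage) (Sum.inl adj) (fun i => (ts i).realize w) ↔
            autAdj ((ts 0).realize w) ((ts 1).realize w) := by
        intro N _ w
        refine iff_of_eq (congrArg _ (funext fun i => ?_))
        fin_cases i <;> rfl
      change RelMap (L := graphAutLanguage) (Sum.inl adj) _ ↔
        RelMap (L := graphAutLanguage) (Sum.inl adj) _
      rw [key, key, h₁ M hF, h₂ M hF, h₁ M' hF', h₂ M' hF', hM.adj_zpow_zpow, hM'.adj_zpow_zpow]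
      exact (hd _ _ _ (by simp)).2
    · exact R.elim
  | imp φ ψ ih₁ ih₂ =>
    obtain ⟨K₁, h₁⟩ := ih₁
    obtain ⟨K₂, h₂⟩ := ih₂
    refine ⟨max K₁ K₂, fun M M' _ _ hF hF' hM hM' v xs v' xs' hd => ?_⟩
    exact imp_congr (h₁ M M' hF hF' hM hM' v xs v' xs' (hd.mono (le_max_left _ _)))
      (h₂ M M' hF hF' hM hM' v xs v' xs' (hd.mono (le_max_right _ _)))
  | @all l φ ih =>
    obtain ⟨K, h⟩ := ih
    have hsnoc : ∀ (N : Type) (w : Fin n → N) (ys : Fin l → N) (c : N),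
        Sum.elim w (Fin.snoc ys c : Fin (l + 1) → N) =
          (fun o : Option (Fin n ⊕ Fin l) => o.elim c (Sum.elim w ys)) ∘
            Sum.elim (fun i => some (Sum.inl i))
              (Fin.snoc (fun i => some (Sum.inr i)) none : Fin (l + 1) → _) := by
      intro N w ys c
      funext x
      rcases x with i | i
      · rfl
      · refine Fin.lastCases ?_ (fun i => ?_) i <;> simp
    have key : ∀ (M M' : Type) [graphAutLanguage.Structure M] [graphAutLanguage.Structure M']
        (hF : IsCycleFreeAut M) (hF' : IsCycleFreeAut M'),
        IsGenericAut (autAdj (M := M)) hF.perm → IsGenericAut (autAdj (M := M')) hF'.perm →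
        ∀ (v : Fin n → M) (xs : Fin l → M) (v' : Fin n → M') (xs' : Fin l → M'),
          SameDiagram (autAdj (M := M)) hF.perm (autAdj (M := M')) hF'.perm (3 * K)
          (Sum.elim v xs) (Sum.elim v' xs') → φ.all.Realize v' xs' → φ.all.Realize v xs := by
      intro M M' _ _ hF hF' hM hM' v xs v' xs' hd hall c
      obtain ⟨d, hcd⟩ := exists_sameDiagram_extend hM hM' hd c
      refine (h M M' hF hF' hM hM' v _ v' _ ?_).2 (hall d)
      rw [hsnoc M v xs c, hsnoc M' v' xs' d]
      exact hcd.comp _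
    exact ⟨3 * K, fun M M' _ _ hF hF' hM hM' v xs v' xs' hd =>
      ⟨key M' M hF' hF hM' hM v' xs' v xs hd.symm, key M M' hF hF' hM hM' v xs v' xs' hd⟩⟩

/-- An embedding commutes with all powers of `f` and preserves and reflects adjacency, so a tuple
and its image have the same diagram for every window. -/
theorem isModelComplete_genericAutTheory : IsModelComplete genericAutTheory := by
  intro M M' e n φ x
  obtain ⟨K, h⟩ := exists_forall_realize_iff φ
  obtain ⟨hT, hE⟩ := model_genericAutTheory_iff.1 (inferInstance : M ⊨ genericAutTheory)
  obtain ⟨hA, hF⟩ := model_cycleFreeAutTheory_iff.1 hT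
  obtain ⟨hT', hE'⟩ := model_genericAutTheory_iff.1 (inferInstance : M' ⊨ genericAutTheory)
  obtain ⟨hA', hF'⟩ := model_cycleFreeAutTheory_iff.1 hT'
  refine h M' M hF' hF (hF'.isGenericAut hA' hE') (hF.isGenericAut hA hE) _ _ _ _
    fun i j k _ => ?_
  have hmap : ∀ y : M, e (autMap y) = autMap (e y) := fun y => by
    refine (e.map_fun _ _).trans (congrArg (funMap _) (funext fun j => ?_))
    rw [Subsingleton.elim j 0]; rfl
  have hadj : ∀ y z : M, autAdj (e y) (e z) ↔ autAdj y z := fun y z => by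
    refine Iff.trans (iff_of_eq (congrArg (RelMap _) (funext fun j => ?_)))
      (e.map_rel (Sum.inl adj) ![y, z])
    fin_cases j <;> rfl
  have hzpow : ∀ (k : ℤ) (y : M), e ((hF.perm ^ k) y) = (hF'.perm ^ k) (e y) := by
    intro k
    induction k using Int.induction_on with
    | zero => intro y; rfl
    | succ n ih =>
      intro y
      rw [zpow_add_one, zpow_add_one, Equiv.Perm.mul_apply, Equiv.Perm.mul_apply, ih]
      exact congrArg _ (hmap y)
    | pred n ih =>
      intro y
      rw [zpow_sub_one, zpow_sub_one, Equiv.Perm.mul_apply, Equiv.Perm.mul_apply, ih]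
      refine congrArg _ ?_
      rw [Equiv.Perm.eq_inv_iff_eq]
      refine (hmap _).symm.trans (congrArg e ?_)
      exact hF.perm.apply_symm_apply y
  have helim : ∀ i, Sum.elim (e ∘ x) (default : Fin 0 → M') i =
      e (Sum.elim x (default : Fin 0 → M) i) := by
    rintro (i | i)
    · rfl
    · exact i.elim0
  rw [helim, helim, ← hzpow]
  exact ⟨e.injective.eq_iff, hadj _ _⟩

end ModelCompleteness

/-! ### Embedding cycle-free automorphisms into generic ones -/

section Embedding

open Structure

/-- A graph with an automorphism extended by new free orbits: the orbit of `new A P t 0` is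
attached to the old graph, and to the other new orbits, by the finite set of neighbours `A` of
`new A P t 0`; the adjacency within the orbit is given by `P`. The tag `t` provides infinitely
many copies. -/
inductive OrbitHull (M : Type) : Type
  | base (x : M) : OrbitHull M
  | new (A : List (OrbitHull M)) (P : List ℕ) (t : ℕ) (k : ℤ) : OrbitHull M

namespace OrbitHull

variable {M : Type}

/-- The `l`-th power of the automorphism. -/
def shift (F : Equiv.Perm M) (l : ℤ) : OrbitHull M → OrbitHull M
  | base x => base ((F ^ l) x)
  | new A P t k => new A P t (k + l)

/-- The tag of a new vertex. -/
def tag : OrbitHull M → ℕ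
  | base _ => 0
  | new _ _ t _ => t

/-- The finite set of neighbours prescribed by a new vertex, moved to the origin of its orbit. -/
def nbrs : OrbitHull M → List (OrbitHull M)
  | base _ => []
  | new A _ _ _ => A

/-- The position of a new vertex in its orbit. -/
def pos : OrbitHull M → ℤ
  | base _ => 0
  | new _ _ _ k => k

/-- `v` is one of the prescribed neighbours of `u`. -/
def Attached (F : Equiv.Perm M) (u v : OrbitHull M) : Prop :=
  shift F (-u.pos) v ∈ u.nbrs

/-- The adjacency of the old graph, and within the new orbits. -/
def OrbitAdj (R : M → M → Prop) : OrbitHull M → OrbitHull M → Prop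
  | base x, base y => R x y
  | new A P t k, new A' P' t' k' => A = A' ∧ P = P' ∧ t = t' ∧ (k - k').natAbs ∈ P
  | _, _ => False

/-- The adjacency of the extended graph. -/
def Adj (R : M → M → Prop) (F : Equiv.Perm M) (u v : OrbitHull M) : Prop :=
  u ≠ v ∧ (Attached F u v ∨ Attached F v u ∨ OrbitAdj R u v)

variable (R : M → M → Prop) (F : Equiv.Perm M)

@[simp]
theorem shift_zero (u : OrbitHull M) : shift F 0 u = u := by
  cases u <;> simp [shift]

theorem shift_shift (k l : ℤ) (u : OrbitHull M) : shift F k (shift F l u) = shift F (k + l) u := by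
  cases u
  · simp [shift, zpow_add]
  · simp [shift]; ring

@[simp]
theorem tag_shift (k : ℤ) (u : OrbitHull M) : (shift F k u).tag = u.tag := by
  cases u <;> rfl

/-- The automorphism of the extended graph. -/
def shiftPerm : Equiv.Perm (OrbitHull M) :=
  ⟨shift F 1, shift F (-1), fun u => by simp [shift_shift], fun u => by simp [shift_shift]⟩

theorem shift_injective (k : ℤ) : Function.Injective (shift F k) := fun u v h => by
  have := congrArg (shift F (-k)) h
  simpa [shift_shift] using this

theorem attached_shift (u v : OrbitHull M) :
    Attached F (shift F 1 u) (shift F 1 v) ↔ Attached F u v := by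
  cases u with
  | base x => simp [Attached, shift, nbrs]
  | new A P t k =>
    rw [Attached, Attached, shift_shift]
    simp [shift, pos, nbrs]

theorem iterate_shift (n : ℕ) (u : OrbitHull M) : (shift F 1)^[n] u = shift F n u := by
  induction n with
  | zero => simp
  | succ n ih =>
    rw [Function.iterate_succ_apply', ih, shift_shift]
    push_cast
    rw [add_comm]

variable {R F}

theorem orbitAdj_shift (hF : ∀ x y, R x y ↔ R (F x) (F y)) (u v : OrbitHull M) :
    OrbitAdj R (shift F 1 u) (shift F 1 v) ↔ OrbitAdj R u v := by
  cases u <;> cases v <;> simp [OrbitAdj, shift, ← hF]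

theorem adj_shift (hF : ∀ x y, R x y ↔ R (F x) (F y)) (u v : OrbitHull M) :
    Adj R F u v ↔ Adj R F (shift F 1 u) (shift F 1 v) := by
  rw [Adj, Adj, attached_shift, attached_shift, orbitAdj_shift hF,
    (shift_injective F 1).ne_iff]

theorem adj_symm (hR : ∀ x y, R x y → R y x) (u v : OrbitHull M) (h : Adj R F u v) :
    Adj R F v u := by
  refine ⟨h.1.symm, ?_⟩
  rcases h.2 with h | h | h
  · exact Or.inr (Or.inl h)
  · exact Or.inl h
  · refine Or.inr (Or.inr ?_)
    cases u <;> cases v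
    · exact hR _ _ h
    · exact h.elim
    · exact h.elim
    · obtain ⟨rfl, rfl, rfl, h⟩ := h
      exact ⟨rfl, rfl, rfl, by rwa [← Int.natAbs_neg, neg_sub]⟩

theorem adj_base (hR : ∀ x, ¬ R x x) (x y : M) : Adj R F (base x) (base y) ↔ R x y := by
  refine ⟨fun h => ?_, fun h => ⟨?_, Or.inr (Or.inr h)⟩⟩
  · rcases h.2 with h | h | h
    · simp [Attached, nbrs] at h
    · simp [Attached, nbrs] at h
    · exact h
  · rintro h'
    cases h'
    exact hR _ h

theorem shift_ne (hF : ∀ n : ℕ, 0 < n → ∀ x, (F ^ n) x ≠ x) (n : ℕ) (hn : 0 < n)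
    (u : OrbitHull M) : shift F n u ≠ u := by
  cases u with
  | base x =>
    intro h
    simp only [shift, zpow_natCast, base.injEq] at h
    exact hF n hn x h
  | new A P t k =>
    intro h
    simp only [shift, new.injEq, true_and] at h
    omega

/-- The witness is a vertex with neighbour list `X`, pattern `P` and a fresh tag; freshness excludes
all unintended adjacencies. -/
theorem orbitExtension : OrbitExtension (Adj R F) (shiftPerm F) := by
  classical
  intro X Y K P hXY
  -- Avoiding the tags in `X ∪ Y` keeps the new orbit apart from `X` and `Y`; avoiding the tags in
  -- their neighbour lists ensures that no element of `Y` is attached to it from its own side.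
  obtain ⟨t, ht⟩ := Infinite.exists_notMem_finset
    ((X ∪ Y).image tag ∪ (X ∪ Y).biUnion fun u => (u.nbrs.toFinset).image tag)
  simp only [Finset.mem_union, Finset.mem_image, Finset.mem_biUnion, List.mem_toFinset,
    not_or, not_exists, not_and] at ht
  obtain ⟨ht1, ht2⟩ := ht
  have hnot : ∀ k, new X.toList P.toList t k ∉ X ∧ new X.toList P.toList t k ∉ Y := fun k =>
    ⟨fun h => ht1 _ (Or.inl h) rfl, fun h => ht1 _ (Or.inr h) rfl⟩
  refine ⟨new X.toList P.toList t 0, (hnot 0).1, (hnot 0).2, fun x hx => ⟨?_, Or.inl ?_⟩, ?_, ?_⟩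
  · rintro rfl
    exact (hnot 0).1 hx
  · simpa [Attached, pos, nbrs] using hx
  · rintro y hy ⟨-, h | h | h⟩
    · refine Finset.disjoint_left.1 hXY ?_ hy
      simpa [Attached, pos, nbrs] using h
    · exact ht2 y (Or.inr hy) _ h (by rw [tag_shift]; rfl)
    · cases y with
      | base y => exact h
      | new A' P' t' k' =>
        obtain ⟨-, -, rfl, -⟩ := h
        exact ht1 _ (Or.inr hy) rfl
  · intro k hk hkK
    have hf : (shiftPerm F)^[k] (new X.toList P.toList t 0) = new X.toList P.toList t k := by
      rw [show ⇑(shiftPerm F) = shift F 1 from rfl, iterate_shift]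
      simp [shift]
    rw [hf]
    constructor
    · rintro ⟨-, h | h | ⟨-, -, -, h⟩⟩
      · exact absurd (by simpa [Attached, pos, nbrs] using h) (hnot _).1
      · exact absurd (by simpa [Attached, pos, nbrs, shift] using h) (hnot _).1
      · simpa using h
    · intro h
      refine ⟨?_, Or.inr (Or.inr ⟨rfl, rfl, rfl, by simpa using h⟩)⟩
      intro e
      simp only [new.injEq, true_and] at e
      omega

end OrbitHull

/-- The interpretation of `f` and `f⁻¹` given by a permutation. -/
@[reducible]
def autStructureOfPerm {V : Type*} (F : Equiv.Perm V) : autLanguage.Structure V :=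
  ⟨fun {_} g => match g with
    | .f => fun x => F (x 0)
    | .fInv => fun x => F.symm (x 0), fun r => r.elim⟩

/-- The structure given by a binary relation and a permutation. -/
@[reducible]
def structureOfPerm {V : Type*} (R : V → V → Prop) (F : Equiv.Perm V) :
    graphAutLanguage.Structure V :=
  letI : Language.graph.Structure V := ⟨fun g => g.elim, fun {_} r => match r with
    | .adj => fun x => R (x 0) (x 1)⟩
  letI : autLanguage.Structure V := autStructureOfPerm F
  FirstOrder.Language.sumStructure _ _ V

theorem OrbitExtension.isRandomGraph {V : Type*} {A : V → V → Prop} {f : V → V}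
    (h : OrbitExtension A f) (h1 : ∀ x, ¬ A x x) (h2 : ∀ x y, A x y → A y x) :
    IsRandomGraph A where
  irrefl := h1
  symm := h2
  ext X Y hXY := by
    obtain ⟨z, hz1, hz2, hz3, hz4, -⟩ := h X Y 0 ∅ hXY
    exact ⟨z, hz1, hz2, hz3, hz4⟩

theorem exists_embedding_genericAutTheory (M : Theory.ModelType.{0, 0, 0} cycleFreeAutTheory) :
    ∃ M' : Theory.ModelType.{0, 0, 0} genericAutTheory, Nonempty (M ↪[graphAutLanguage] M') := by
  obtain ⟨hA, hF⟩ := model_cycleFreeAutTheory_iff.1 (inferInstance : M ⊨ cycleFreeAutTheory)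
  have hpow : ∀ n : ℕ, 0 < n → ∀ x, (hF.perm ^ n) x ≠ x := fun n hn x => by
    rw [← Equiv.Perm.iterate_eq_pow]
    exact hF.iterate_ne n hn x
  let R : OrbitHull M → OrbitHull M → Prop := OrbitHull.Adj autAdj hF.perm
  let G : Equiv.Perm (OrbitHull M) := OrbitHull.shiftPerm hF.perm
  let S : graphAutLanguage.Structure (OrbitHull M) := structureOfPerm R G
  have hE : OrbitExtension (autAdj (M := OrbitHull M)) autMap := OrbitHull.orbitExtension
  have hT : OrbitHull M ⊨ genericAutTheory := by
    refine model_genericAutTheory_iff.2 ⟨model_cycleFreeAutTheory_iff.2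
      ⟨hE.isRandomGraph (fun u h => h.1 rfl) (OrbitHull.adj_symm hA.symm),
      G.apply_symm_apply, G.symm_apply_apply, OrbitHull.adj_shift hF.map_adj,
      fun n hn u => ?_⟩, hE⟩
    rw [show (autMap (M := OrbitHull M)) = OrbitHull.shift hF.perm 1 from rfl,
      OrbitHull.iterate_shift]
    exact OrbitHull.shift_ne hpow n hn u
  have : Nonempty (OrbitHull M) := ⟨OrbitHull.base (Classical.arbitrary M)⟩
  refine ⟨Theory.ModelType.of genericAutTheory (OrbitHull M), ⟨?_⟩⟩
  refine ⟨⟨OrbitHull.base, fun x y h => OrbitHull.base.inj h⟩, ?_, ?_⟩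
  · intro n g x
    rcases g with g | g
    · exact g.elim
    · cases g with
      | f =>
        refine Eq.trans (congrArg OrbitHull.base (?_ : _ = (hF.perm ^ (1 : ℤ)) (x 0))) rfl
        rw [zpow_one]
        refine congrArg (funMap _) (funext fun j => ?_)
        rw [Subsingleton.elim j 0]; rfl
      | fInv =>
        refine Eq.trans (congrArg OrbitHull.base (?_ : _ = (hF.perm ^ (-1 : ℤ)) (x 0))) rfl
        rw [zpow_neg_one]
        refine congrArg (funMap _) (funext fun j => ?_)
        rw [Subsingleton.elim j 0]; rfl
  · intro n r x
    rcases r with r | r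
    · cases r
      refine Iff.trans (OrbitHull.adj_base hA.irrefl (x 0) (x 1)) (iff_of_eq ?_)
      refine congrArg (RelMap _) (funext fun j => ?_)
      fin_cases j <;> rfl
    · exact r.elim

theorem isModelCompanion_genericAutTheory :
    IsModelCompanion cycleFreeAutTheory genericAutTheory := by
  refine ⟨exists_embedding_genericAutTheory, fun M => ?_, isModelComplete_genericAutTheory⟩
  have : M ⊨ cycleFreeAutTheory :=
    (model_genericAutTheory_iff.1 (inferInstance : M ⊨ genericAutTheory)).1
  exact ⟨Theory.ModelType.of cycleFreeAutTheory M, ⟨Embedding.refl _ M⟩⟩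

end Embedding

/-! ### Finite partial automorphisms without cycles -/

section PartialAutomorphisms

variable {N : Type*} {R : N → N → Prop}

/-- A finite partial automorphism without cycles, given by its graph. -/
structure IsPartialAut (R : N → N → Prop) (p : Finset (N × N)) : Prop where
  fst_eq_iff : ∀ q ∈ p, ∀ q' ∈ p, q.1 = q'.1 ↔ q.2 = q'.2
  map_adj : ∀ q ∈ p, ∀ q' ∈ p, R q.1 q'.1 ↔ R q.2 q'.2
  acyclic : ∀ x, ¬ Relation.TransGen (fun x y => (x, y) ∈ p) x x

/-- An automorphism without finite cycles. -/
structure IsCycleFreePerm (R : N → N → Prop) (F : Equiv.Perm N) : Prop where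
  map_adj : ∀ x y, R x y ↔ R (F x) (F y)
  pow_ne : ∀ n : ℕ, 0 < n → ∀ x, (F ^ n) x ≠ x

/-- `F` extends the finite partial map `p`. -/
def Extends (F : N → N) (p : Finset (N × N)) : Prop := ∀ q ∈ p, F q.1 = q.2

/-! ### One-point extensions of finite partial automorphisms. -/

theorem IsRandomGraph.exists_adj_iff (hR : IsRandomGraph R) (T : Finset N) (C : N → Prop) :
    ∃ w, w ∉ T ∧ ∀ y ∈ T, R w y ↔ C y := by
  classical
  obtain ⟨w, h1, h2, h3, h4⟩ := hR.ext (T.filter C) (T.filter fun y => ¬ C y)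
    (Finset.disjoint_filter_filter_not _ _ _)
  simp only [Finset.mem_filter, not_and, not_not] at h1 h2 h3 h4
  exact ⟨w, fun h => h1 h (h2 h), fun y hy => ⟨fun h => by_contra fun hc => h4 y ⟨hy, hc⟩ h,
    fun h => h3 y ⟨hy, h⟩⟩⟩

/-- Adjacency of the new value `w` is forced only on the range of `p`, where it copies the adjacency
of `b` on the domain; elsewhere it is free. -/
theorem IsPartialAut.exists_insert [DecidableEq N] (hR : IsRandomGraph R) {p : Finset (N × N)}
    (hp : IsPartialAut R p) {b : N} (hb : ∀ y, (b, y) ∉ p) (T : Finset N) (C : N → Prop) :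
    ∃ w, (∀ y ∈ T, (∀ x, (x, y) ∉ p) → (R w y ↔ C y)) ∧ IsPartialAut R (insert (b, w) p) := by
  classical
  obtain ⟨w, hw, hwR⟩ := hR.exists_adj_iff
    (insert b (T ∪ (p.image Prod.fst ∪ p.image Prod.snd)))
    (fun y => if ∃ x, (x, y) ∈ p then ∃ x, (x, y) ∈ p ∧ R b x else C y)
  simp only [Finset.mem_insert, Finset.mem_union, Finset.mem_image, not_or, not_exists,
    not_and] at hw hwR
  obtain ⟨hwb, -, hw1, hw2⟩ := hw
  have hadj : ∀ q ∈ p, (R b q.1 ↔ R w q.2) := by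
    intro q hq
    rw [hwR q.2 (Or.inr (Or.inr (Or.inr ⟨q, hq, rfl⟩))), if_pos ⟨q.1, hq⟩]
    refine ⟨fun h => ⟨q.1, hq, h⟩, ?_⟩
    rintro ⟨x, hx, h⟩
    rwa [← (hp.fst_eq_iff _ hx _ hq).2 rfl]
  have hadj' : ∀ q ∈ p, (R q.1 b ↔ R q.2 w) := fun q hq =>
    ⟨fun h => hR.symm _ _ ((hadj q hq).1 (hR.symm _ _ h)),
      fun h => hR.symm _ _ ((hadj q hq).2 (hR.symm _ _ h))⟩
  refine ⟨w, fun y hy hyp => ?_, ?_, ?_, ?_⟩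
  · rw [hwR y (Or.inr (Or.inl hy)), if_neg (by simpa using hyp)]
  · intro q hq q' hq'
    rcases Finset.mem_insert.1 hq with rfl | hq <;> rcases Finset.mem_insert.1 hq' with rfl | hq'
    · simp
    · exact iff_of_false (fun h => hb q'.2 (by rw [show b = q'.1 from h]; exact hq'))
        (fun h => hw2 _ hq' h.symm)
    · exact iff_of_false (fun h => hb q.2 (by rw [show b = q.1 from h.symm]; exact hq))
        (fun h => hw2 _ hq h)
    · exact hp.fst_eq_iff _ hq _ hq'
  · intro q hq q' hq'
    rcases Finset.mem_insert.1 hq with rfl | hq <;> rcases Finset.mem_insert.1 hq' with rfl | hq'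
    · exact iff_of_false (hR.irrefl _) (hR.irrefl _)
    · exact hadj q' hq'
    · exact hadj' q hq
    · exact hp.map_adj _ hq _ hq'
  -- Since `w` is outside the domain and differs from `b`, no arrow leaves it, so a path can use the
  -- new arrow only as its last step.
  · have hpath : ∀ x y, Relation.TransGen (fun x y => (x, y) ∈ insert (b, w) p) x y →
        y = w ∨ Relation.TransGen (fun x y => (x, y) ∈ p) x y := by
      intro x y h
      induction h with
      | single h =>
        rcases Finset.mem_insert.1 h with h | h
        · exact Or.inl (Prod.mk.inj h).2
        · exact Or.inr (.single h)
      | tail _ h ih =>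
        rcases Finset.mem_insert.1 h with h' | h'
        · exact Or.inl (Prod.mk.inj h').2
        · rcases ih with ih | ih
          · exact (hw1 _ h' ih).elim
          · exact Or.inr (ih.tail h')
    intro x hx
    rcases hpath x x hx with rfl | h
    · obtain ⟨c, hc, -⟩ := Relation.TransGen.head'_iff.1 hx
      rcases Finset.mem_insert.1 hc with h | h
      · exact hwb (Prod.mk.inj h).1
      · exact hw1 _ h rfl
    · exact hp.acyclic x h

theorem IsPartialAut.swap [DecidableEq N] {p : Finset (N × N)} (hp : IsPartialAut R p) :
    IsPartialAut R (p.image Prod.swap) := by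
  have hmem : ∀ q, q ∈ p.image Prod.swap ↔ q.swap ∈ p := fun q => by
    rw [Finset.mem_image]
    exact ⟨by rintro ⟨a, ha, rfl⟩; simpa using ha, fun h => ⟨_, h, q.swap_swap⟩⟩
  refine ⟨fun q hq q' hq' => ?_, fun q hq q' hq' => ?_, fun x hx => ?_⟩
  · exact (hp.fst_eq_iff _ ((hmem q).1 hq) _ ((hmem q').1 hq')).symm
  · exact (hp.map_adj _ ((hmem q).1 hq) _ ((hmem q').1 hq')).symm
  · refine hp.acyclic x ?_
    rw [← Relation.transGen_swap]
    refine Relation.TransGen.mono (fun a b h => ?_) _ _ hx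
    exact (hmem _).1 h

theorem IsPartialAut.exists_mem_fst (hR : IsRandomGraph R) {p : Finset (N × N)}
    (hp : IsPartialAut R p) (b : N) : ∃ q, p ⊆ q ∧ IsPartialAut R q ∧ ∃ w, (b, w) ∈ q := by
  classical
  by_cases hb : ∃ w, (b, w) ∈ p
  · exact ⟨p, subset_rfl, hp, hb⟩
  · push Not at hb
    obtain ⟨w, -, hw⟩ := hp.exists_insert hR hb ∅ fun _ => True
    exact ⟨_, Finset.subset_insert _ _, hw, w, Finset.mem_insert_self _ _⟩

theorem IsPartialAut.exists_mem_snd (hR : IsRandomGraph R) {p : Finset (N × N)}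
    (hp : IsPartialAut R p) (b : N) : ∃ q, p ⊆ q ∧ IsPartialAut R q ∧ ∃ w, (w, b) ∈ q := by
  classical
  obtain ⟨q, hpq, hq, w, hw⟩ := hp.swap.exists_mem_fst hR b
  refine ⟨q.image Prod.swap, fun x hx => ?_, hq.swap, w, ?_⟩
  · exact Finset.mem_image.2 ⟨x.swap, hpq (Finset.mem_image_of_mem _ hx), x.swap_swap⟩
  · exact Finset.mem_image.2 ⟨_, hw, rfl⟩

theorem IsPartialAut.empty : IsPartialAut R ∅ := by
  refine ⟨by simp, by simp, fun x hx => ?_⟩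
  obtain ⟨c, hc, -⟩ := Relation.TransGen.head'_iff.1 hx
  simp at hc

theorem IsCycleFreePerm.isPartialAut [DecidableEq N] {F : Equiv.Perm N} (hF : IsCycleFreePerm R F)
    (T : Finset N) : IsPartialAut R (T.image fun x => (x, F x)) := by
  refine ⟨?_, ?_, ?_⟩
  · simp only [Finset.mem_image]
    rintro _ ⟨x, -, rfl⟩ _ ⟨y, -, rfl⟩
    exact F.injective.eq_iff.symm
  · simp only [Finset.mem_image]
    rintro _ ⟨x, -, rfl⟩ _ ⟨y, -, rfl⟩
    exact hF.map_adj x y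
  · have hpath : ∀ x y, Relation.TransGen
        (fun x y => (x, y) ∈ T.image fun x => (x, F x)) x y → ∃ n : ℕ, 0 < n ∧ (F ^ n) x = y := by
      intro x y h
      have hstep : ∀ y z, (y, z) ∈ T.image (fun x => (x, F x)) → F y = z := by
        intro y z h
        obtain ⟨a, -, ha⟩ := Finset.mem_image.1 h
        obtain ⟨rfl, rfl⟩ := Prod.mk.inj ha
        rfl
      induction h with
      | single h => exact ⟨1, one_pos, hstep _ _ h⟩
      | tail _ h ih =>
        obtain ⟨n, -, rfl⟩ := ih
        refine ⟨n + 1, n.succ_pos, ?_⟩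
        rw [pow_succ', Equiv.Perm.mul_apply, hstep _ _ h]
    intro x hx
    obtain ⟨n, hn, h⟩ := hpath x x hx
    exact hF.pow_ne n hn x h

/-- The finite partial automorphisms without cycles, ordered by extension. -/
abbrev PartialAut (R : N → N → Prop) : Type _ := {p : Finset (N × N) // IsPartialAut R p}

/-- By directedness, finitely many values of the limit map already lie in one member of the ideal.
Injectivity, adjacency and the absence of finite cycles are therefore inherited from the members. -/
theorem exists_perm_of_ideal (I : Order.Ideal (PartialAut R))
    (h₁ : ∀ x, ∃ p ∈ I, ∃ y, (x, y) ∈ p.1) (h₂ : ∀ y, ∃ p ∈ I, ∃ x, (x, y) ∈ p.1) :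
    ∃ F : Equiv.Perm N, IsCycleFreePerm R F ∧ ∀ p ∈ I, Extends F p.1 := by
  choose u hu f hf using h₁
  choose v hv g hg using h₂
  have hcommon : ∀ p ∈ I, ∀ q ∈ I, ∃ r ∈ I, p.1 ⊆ r.1 ∧ q.1 ⊆ r.1 := fun p hp q hq => by
    obtain ⟨r, hr, h⟩ := I.directed p hp q hq
    exact ⟨r, hr, h⟩
  have hinj : ∀ p ∈ I, ∀ q ∈ I, ∀ s ∈ p.1, ∀ t ∈ q.1, s.1 = t.1 ↔ s.2 = t.2 := by
    intro p hp q hq s hs t ht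
    obtain ⟨r, -, hpr, hqr⟩ := hcommon p hp q hq
    exact r.2.fst_eq_iff _ (hpr hs) _ (hqr ht)
  refine ⟨⟨f, g, fun x => ?_, fun y => ?_⟩, ⟨fun x y => ?_, fun n hn x hx => ?_⟩, ?_⟩
  · exact (hinj _ (hv (f x)) _ (hu x) _ (hg (f x)) _ (hf x)).2 rfl
  · exact (hinj _ (hu (g y)) _ (hv y) _ (hf (g y)) _ (hg y)).1 rfl
  · obtain ⟨r, -, hxr, hyr⟩ := hcommon _ (hu x) _ (hu y)
    exact r.2.map_adj _ (hxr (hf x)) _ (hyr (hf y))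
  · have hpath : ∀ n : ℕ, ∃ p ∈ I,
        Relation.TransGen (fun x y => (x, y) ∈ p.1) x (f^[n + 1] x) := by
      intro n
      induction n with
      | zero => exact ⟨u x, hu x, .single (hf x)⟩
      | succ n ih =>
        obtain ⟨p, hp, h⟩ := ih
        obtain ⟨r, hr, hpr, hyr⟩ := hcommon _ hp _ (hu (f^[n + 1] x))
        refine ⟨r, hr, (Relation.TransGen.mono (fun a b hab => hpr hab) _ _ h).tail ?_⟩
        rw [Function.iterate_succ_apply' f (n + 1)]
        exact hyr (hf _)
    obtain ⟨m, rfl⟩ : ∃ m, n = m + 1 := ⟨n - 1, by omega⟩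
    obtain ⟨p, -, h⟩ := hpath m
    rw [← Equiv.Perm.iterate_eq_pow] at hx
    refine p.2.acyclic x ?_
    convert h using 1
    exact hx.symm
  · intro p hp q hq
    exact (hinj _ (hu q.1) _ hp _ (hf q.1) _ hq).1 rfl

/-- Every finite partial automorphism without cycles extends to a total one that meets countably
many given cofinal sets. -/
theorem exists_perm_extends [Countable N] (hR : IsRandomGraph R) {ι : Type*} [Countable ι]
    (D : ι → Order.Cofinal (PartialAut R)) (p : PartialAut R) :
    ∃ F : Equiv.Perm N, IsCycleFreePerm R F ∧ Extends F p.1 ∧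
      ∀ i, ∃ q ∈ D i, Extends F q.1 := by
  -- Besides the given requirements, each vertex must enter the domain and the range. This is a
  -- countable family, so some ideal meets all of it.
  let E₁ : N → Order.Cofinal (PartialAut R) := fun x => ⟨{q | ∃ y, (x, y) ∈ q.1}, fun q => by
    obtain ⟨r, hqr, hr, h⟩ := q.2.exists_mem_fst hR x
    exact ⟨⟨r, hr⟩, h, hqr⟩⟩
  let E₂ : N → Order.Cofinal (PartialAut R) := fun y => ⟨{q | ∃ x, (x, y) ∈ q.1}, fun q => by
    obtain ⟨r, hqr, hr, h⟩ := q.2.exists_mem_snd hR y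
    exact ⟨⟨r, hr⟩, h, hqr⟩⟩
  let _ : Encodable ((N ⊕ N) ⊕ ι) := Encodable.ofCountable _
  let E : (N ⊕ N) ⊕ ι → Order.Cofinal (PartialAut R) := Sum.elim (Sum.elim E₁ E₂) D
  have hE := Order.cofinal_meets_idealOfCofinals p E
  obtain ⟨F, hF, hI⟩ := exists_perm_of_ideal (Order.idealOfCofinals p E)
    (fun x => by
      obtain ⟨q, hq, hqI⟩ := hE (Sum.inl (Sum.inl x))
      exact ⟨q, hqI, hq⟩)
    (fun y => by
      obtain ⟨q, hq, hqI⟩ := hE (Sum.inl (Sum.inr y))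
      exact ⟨q, hqI, hq⟩)
  refine ⟨F, hF, hI p (Order.mem_idealOfCofinals p E), fun i => ?_⟩
  obtain ⟨q, hq, hqI⟩ := hE (Sum.inr i)
  exact ⟨q, hq, hI q hqI⟩

theorem IsCycleFreePerm.zpow_apply_injective {F : Equiv.Perm N} (hF : IsCycleFreePerm R F)
    (z : N) : Function.Injective fun k : ℤ => (F ^ k) z := by
  have hlt : ∀ k l : ℤ, k < l → (F ^ k) z ≠ (F ^ l) z := by
    intro k l hkl h
    obtain ⟨n, rfl⟩ : ∃ n : ℕ, l = n + k := ⟨(l - k).natAbs, by omega⟩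
    rw [zpow_add, Equiv.Perm.mul_apply, zpow_natCast] at h
    exact hF.pow_ne n (by omega) _ h.symm
  intro k l h
  rcases lt_trichotomy k l with hkl | hkl | hkl
  · exact absurd h (hlt k l hkl)
  · exact hkl
  · exact absurd h.symm (hlt l k hkl)

/-- The set of all `n` such that `Fⁿ z` is adjacent to `z` can be made different from any given
set by extending a finite partial automorphism. -/
theorem isCofinal_orbit_ne [Countable N] (hR : IsRandomGraph R) (S : Set ℕ) (z : N) :
    IsCofinal {q : PartialAut R | ∀ F : Equiv.Perm N, IsCycleFreePerm R F → Extends F q.1 →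
      ∃ n : ℕ, ¬ (R ((F ^ n) z) z ↔ n ∈ S)} := by
  classical
  intro p
  -- A total extension `G` of `p` serves only to supply a long segment of the orbit of `z`; a finite
  -- part of it is kept.
  obtain ⟨G, hG, hGp, -⟩ := exists_perm_extends hR (Empty.elim : Empty → _) p
  have hfin : {k : ℤ | (G ^ k) z ∈ p.1.image Prod.fst ∪ p.1.image Prod.snd}.Finite :=
    (Finset.finite_toSet _).preimage (hG.zpow_apply_injective z).injOn
  obtain ⟨m, hm⟩ : ∃ m : ℕ, ∀ k : ℤ, (m : ℤ) ≤ |k| →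
      (G ^ k) z ∉ p.1.image Prod.fst ∪ p.1.image Prod.snd := by
    refine ⟨hfin.toFinset.sup Int.natAbs + 1, fun k hk h => ?_⟩
    have h1 : k.natAbs ≤ hfin.toFinset.sup Int.natAbs :=
      Finset.le_sup (f := Int.natAbs) (hfin.mem_toFinset.2 h)
    rw [Int.abs_eq_natAbs] at hk
    omega
  -- With the interval half-open, the kept part runs from `G⁻ᵐ z` to `Gᵐ z`, leaving the last point
  -- without an image. By the choice of `m`, the first point has no preimage.
  let T : Finset N := p.1.image Prod.fst ∪
    (Finset.Ico (-(m : ℤ)) m).image fun k => (G ^ k) z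
  have hT : ∀ x, x ∈ T ↔ x ∈ p.1.image Prod.fst ∨ ∃ k : ℤ, (-(m : ℤ) ≤ k ∧ k < m) ∧
      (G ^ k) z = x := fun x => by
    rw [Finset.mem_union, Finset.mem_image (s := Finset.Ico _ _)]
    simp only [Finset.mem_Ico]
  have hq := hG.isPartialAut T
  have hmem : ∀ x y, (x, y) ∈ (T.image fun x => (x, G x)) → x ∈ T ∧ G x = y := by
    intro x y h
    obtain ⟨a, ha, hxy⟩ := Finset.mem_image.1 h
    obtain ⟨rfl, rfl⟩ := Prod.mk.inj hxy
    exact ⟨ha, rfl⟩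
  have hpq : p.1 ⊆ T.image fun x => (x, G x) := fun s hs => Finset.mem_image.2
    ⟨s.1, (hT _).2 (Or.inl (Finset.mem_image_of_mem _ hs)), by rw [hGp s hs]⟩
  have hb : ∀ y, ((G ^ (m : ℤ)) z, y) ∉ T.image fun x => (x, G x) := by
    intro y h
    rcases (hT _).1 (hmem _ _ h).1 with h | ⟨k, hk, hkz⟩
    · exact hm m (by simp) (Finset.mem_union_left _ h)
    · have := hG.zpow_apply_injective z hkz
      omega
  have ha : ∀ x, (x, (G ^ (-(m : ℤ))) z) ∉ T.image fun x => (x, G x) := by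
    intro x h
    obtain ⟨hx, hxa⟩ := hmem _ _ h
    rcases (hT _).1 hx with h | ⟨k, hk, rfl⟩
    · obtain ⟨s, hs, rfl⟩ := Finset.mem_image.1 h
      refine hm (-(m : ℤ)) (by simp) (Finset.mem_union_right _ ?_)
      rw [← hxa, hGp s hs]
      exact Finset.mem_image_of_mem _ hs
    · have h1 : (G ^ (1 + k)) z = (G ^ (-(m : ℤ))) z := by
        rw [zpow_add, Equiv.Perm.mul_apply, zpow_one, hxa]
      have := hG.zpow_apply_injective z h1
      omega
  -- The image `w` of the last point is `2 * m + 1` steps after the first. The first point is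
  -- outside the range, so its adjacency to `w` is free and can be made to disagree with `S`.
  obtain ⟨w, hw, hwq⟩ := hq.exists_insert hR hb {(G ^ (-(m : ℤ))) z}
    fun _ => 2 * m + 1 ∉ S
  have hwa := hw _ (Finset.mem_singleton_self _) ha
  refine ⟨⟨_, hwq⟩, fun F hF hFq => ⟨2 * m + 1, ?_⟩,
    hpq.trans (Finset.subset_insert _ _)⟩
  have hpow : ∀ j : ℕ, j ≤ 2 * m → (F ^ j) ((G ^ (-(m : ℤ))) z) = (G ^ ((j : ℤ) - m)) z := by
    intro j
    induction j with
    | zero => intro _; simp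
    | succ j ih =>
      intro hj
      rw [pow_succ', Equiv.Perm.mul_apply, ih (by omega)]
      have hx : (G ^ ((j : ℤ) - m)) z ∈ T :=
        (hT _).2 (Or.inr ⟨(j : ℤ) - m, by omega, rfl⟩)
      refine (hFq ((G ^ ((j : ℤ) - m)) z, G ((G ^ ((j : ℤ) - m)) z))
        (Finset.mem_insert_of_mem (Finset.mem_image.2 ⟨_, hx, rfl⟩))).trans ?_
      rw [show ((j + 1 : ℕ) : ℤ) - m = 1 + ((j : ℤ) - m) by push_cast; ring, zpow_add,
        Equiv.Perm.mul_apply, zpow_one]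
  have hz : (F ^ m) ((G ^ (-(m : ℤ))) z) = z := by
    rw [hpow m (by omega), sub_self]; rfl
  have hw' : (F ^ (2 * m + 1)) ((G ^ (-(m : ℤ))) z) = w := by
    rw [pow_succ', Equiv.Perm.mul_apply, hpow _ le_rfl,
      show ((2 * m : ℕ) : ℤ) - m = m by push_cast; ring]
    exact hFq (_, w) (Finset.mem_insert_self _ _)
  have hadj : ∀ (n : ℕ) (x y : N), R ((F ^ n) x) ((F ^ n) y) ↔ R x y := by
    intro n
    induction n with
    | zero => intro x y; rfl
    | succ n ih =>
      intro x y
      rw [pow_succ', Equiv.Perm.mul_apply, Equiv.Perm.mul_apply, ← hF.map_adj, ih]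
  -- Applying `Fᵐ` to the first point and to `w` gives `z` and its translate by `2 * m + 1`.
  have hmain : R ((F ^ (2 * m + 1)) z) z ↔ R w ((G ^ (-(m : ℤ))) z) := by
    conv_lhs => rw [← hz]
    rw [← Equiv.Perm.mul_apply, ← pow_add, add_comm, pow_add, Equiv.Perm.mul_apply, hw', hadj]
  rw [hmain, hwa]
  tauto

end PartialAutomorphisms

/-! ### The space of cycle-free automorphisms and the absence of Truss generic ones -/

section Generic

open Structure

variable {N : Type*} [Language.graph.Structure N]

/-- The interpretation of `f` in an expansion. -/
def Expansion.map (σ : Expansion Language.graph autLanguage N) (x : N) : N :=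
  letI : autLanguage.Structure N := σ
  funMap (L := autLanguage) AutFunctions.f ![x]

/-- The interpretation of `f⁻¹` in an expansion. -/
def Expansion.inv (σ : Expansion Language.graph autLanguage N) (x : N) : N :=
  letI : autLanguage.Structure N := σ
  funMap (L := autLanguage) AutFunctions.fInv ![x]

theorem mem_Exp_iff [hN : N ⊨ randomGraphTheory] (σ : Expansion Language.graph autLanguage N) :
    σ ∈ Exp N cycleFreeAutTheory ↔
      letI := σ.toStructure
      IsCycleFreeAut N := by
  let _ := σ.toStructure
  refine Iff.trans model_cycleFreeAutTheory_iff (and_iff_right ?_)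
  exact model_randomGraphTheory_iff.1 hN

theorem exists_perm_of_mem_Exp [N ⊨ randomGraphTheory]
    {σ : Expansion Language.graph autLanguage N} (hσ : σ ∈ Exp N cycleFreeAutTheory) :
    ∃ F : Equiv.Perm N, IsCycleFreePerm (fun x y : N => RelMap adj ![x, y]) F ∧
      (∀ x, F x = σ.map x) ∧ ∀ x, F.symm x = σ.inv x := by
  let _ := σ.toStructure
  have h := (mem_Exp_iff σ).1 hσ
  refine ⟨h.perm, ⟨h.map_adj, fun n hn x => ?_⟩, fun _ => rfl, fun _ => rfl⟩
  rw [← Equiv.Perm.iterate_eq_pow]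
  exact h.iterate_ne n hn x

/-- The expansion given by a permutation. -/
def Expansion.ofPerm (F : Equiv.Perm N) : Expansion Language.graph autLanguage N :=
  autStructureOfPerm F

theorem IsCycleFreePerm.ofPerm_mem_Exp [N ⊨ randomGraphTheory] {F : Equiv.Perm N}
    (hF : IsCycleFreePerm (fun x y : N => RelMap adj ![x, y]) F) :
    Expansion.ofPerm F ∈ Exp N cycleFreeAutTheory := by
  let _ := (Expansion.ofPerm F).toStructure
  refine (mem_Exp_iff _).2 ⟨F.apply_symm_apply, F.symm_apply_apply, hF.map_adj,
    fun n hn x => ?_⟩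
  have := hF.pow_ne n hn x
  rwa [← Equiv.Perm.iterate_eq_pow] at this

/-! ### The topology in terms of finite partial maps. -/

theorem isOpen_map_eq (x y : N) :
    IsOpen {σ : Expansion Language.graph autLanguage N | σ.map x = y} := by
  refine TopologicalSpace.isOpen_generateFrom_of_mem
    ⟨Term.equal (Functions.apply₁ (Sum.inr AutFunctions.f : graphAutLanguage.Functions 1)
      (Term.var x)) (Term.var y), (BoundedFormula.IsAtomic.equal _ _).isQF, ?_⟩
  ext σ
  let _ := σ.toStructure
  have h : ∀ g : graphAutLanguage.Functions 1,
      funMap g ![x] = y ↔ (Term.equal (g.apply₁ (Term.var x)) (Term.var y)).Realize id := by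
    intro g
    rw [Formula.realize_equal, Term.realize_functions_apply₁]
    rfl
  exact h (Sum.inr AutFunctions.f)

theorem isOpen_extends (p : Finset (N × N)) :
    IsOpen {σ : Expansion Language.graph autLanguage N | Extends σ.map p} := by
  have : {σ : Expansion Language.graph autLanguage N | Extends σ.map p} =
      ⋂ q ∈ p, {σ | σ.map q.1 = q.2} := by
    ext σ
    simp [Extends]
  rw [this]
  exact isOpen_biInter_finset fun q _ => isOpen_map_eq q.1 q.2

/-- The expansions `σ` and `σ'` agree on `T`. -/
def Expansion.AgreeOn (σ σ' : Expansion Language.graph autLanguage N) (T : Finset N) : Prop :=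
  ∀ x ∈ T, σ'.map x = σ.map x ∧ σ'.inv x = σ.inv x

theorem Expansion.AgreeOn.mono {σ σ' : Expansion Language.graph autLanguage N} {T T' : Finset N}
    (h : σ.AgreeOn σ' T') (hT : T ⊆ T') : σ.AgreeOn σ' T := fun x hx => h x (hT hx)

/-- The value of a term in an expansion. -/
def Expansion.termValue (σ : Expansion Language.graph autLanguage N) {α : Type*} (v : α → N)
    (t : graphAutLanguage.Term α) : N :=
  letI := σ.toStructure
  t.realize v

/-- The truth of a formula in an expansion. -/
def Expansion.Holds (σ : Expansion Language.graph autLanguage N) {α : Type*} {n : ℕ} (v : α → N)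
    (xs : Fin n → N) (φ : graphAutLanguage.BoundedFormula α n) : Prop :=
  letI := σ.toStructure
  φ.Realize v xs

/-- Evaluating a term applies `f` and `f⁻¹` at finitely many points, namely the values of its
subterms under `σ`. -/
theorem Expansion.exists_termValue_eq (σ : Expansion Language.graph autLanguage N) {α : Type*}
    (v : α → N) (t : graphAutLanguage.Term α) :
    ∃ T : Finset N, ∀ σ', σ.AgreeOn σ' T → σ'.termValue v t = σ.termValue v t := by
  classical
  induction t with
  | var i => exact ⟨∅, fun _ _ => rfl⟩
  | @func l g ts ih =>
    rcases g with g | g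
    · exact g.elim
    · have hfun : ∀ (ρ : Expansion Language.graph autLanguage N) (ts : Fin 1 → _),
          (fun j => ρ.termValue v (ts j)) = ![ρ.termValue v (ts 0)] := fun ρ ts =>
        funext fun j => by rw [Subsingleton.elim j 0]; rfl
      cases g with
      | f =>
        obtain ⟨T, hT⟩ := ih 0
        refine ⟨insert (σ.termValue v (ts 0)) T, fun σ' h => ?_⟩
        have hval : ∀ ρ : Expansion Language.graph autLanguage N,
            ρ.termValue v (Term.func (Sum.inr AutFunctions.f) ts) =
              ρ.map (ρ.termValue v (ts 0)) := fun ρ => by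
          let _ : autLanguage.Structure N := ρ
          exact congrArg (funMap (L := autLanguage) AutFunctions.f) (hfun ρ ts)
        rw [hval, hval, hT σ' (h.mono (Finset.subset_insert _ _))]
        exact (h _ (Finset.mem_insert_self _ _)).1
      | fInv =>
        obtain ⟨T, hT⟩ := ih 0
        refine ⟨insert (σ.termValue v (ts 0)) T, fun σ' h => ?_⟩
        have hval : ∀ ρ : Expansion Language.graph autLanguage N,
            ρ.termValue v (Term.func (Sum.inr AutFunctions.fInv) ts) =
              ρ.inv (ρ.termValue v (ts 0)) := fun ρ => by
          let _ : autLanguage.Structure N := ρ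
          exact congrArg (funMap (L := autLanguage) AutFunctions.fInv) (hfun ρ ts)
        rw [hval, hval, hT σ' (h.mono (Finset.subset_insert _ _))]
        exact (h _ (Finset.mem_insert_self _ _)).2

theorem Expansion.exists_holds_iff (σ : Expansion Language.graph autLanguage N) {α : Type*}
    (v : α → N) {n : ℕ} (xs : Fin n → N) {φ : graphAutLanguage.BoundedFormula α n}
    (hφ : φ.IsQF) :
    ∃ T : Finset N, ∀ σ', σ.AgreeOn σ' T → (σ'.Holds v xs φ ↔ σ.Holds v xs φ) := by
  classical
  induction hφ with
  | falsum => exact ⟨∅, fun _ _ => Iff.rfl⟩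
  | of_isAtomic h =>
    cases h with
    | equal t₁ t₂ =>
      obtain ⟨T₁, h₁⟩ := σ.exists_termValue_eq (Sum.elim v xs) t₁
      obtain ⟨T₂, h₂⟩ := σ.exists_termValue_eq (Sum.elim v xs) t₂
      refine ⟨T₁ ∪ T₂, fun σ' h => ?_⟩
      change σ'.termValue _ t₁ = σ'.termValue _ t₂ ↔ σ.termValue _ t₁ = σ.termValue _ t₂
      rw [h₁ σ' (h.mono Finset.subset_union_left), h₂ σ' (h.mono Finset.subset_union_right)]
    | @rel l r ts =>
      rcases r with r | r
      · choose T hT using fun i => σ.exists_termValue_eq (Sum.elim v xs) (ts i)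
        refine ⟨Finset.univ.biUnion T, fun σ' h => ?_⟩
        change RelMap r (fun i => σ'.termValue _ (ts i)) ↔ RelMap r (fun i => σ.termValue _ (ts i))
        rw [funext fun i => hT i σ' (h.mono (Finset.subset_biUnion_of_mem T (Finset.mem_univ i)))]
      · exact r.elim
  | imp _ _ ih₁ ih₂ =>
    obtain ⟨T₁, h₁⟩ := ih₁
    obtain ⟨T₂, h₂⟩ := ih₂
    exact ⟨T₁ ∪ T₂, fun σ' h => imp_congr (h₁ σ' (h.mono Finset.subset_union_left))
      (h₂ σ' (h.mono Finset.subset_union_right))⟩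

theorem Expansion.exists_agreeOn_subset {U : Set (Expansion Language.graph autLanguage N)}
    (hU : IsOpen U) {σ : Expansion Language.graph autLanguage N} (hσ : σ ∈ U) :
    ∃ T : Finset N, ∀ σ', σ.AgreeOn σ' T → σ' ∈ U := by
  classical
  induction hU with
  | basic s hs =>
    obtain ⟨φ, hφ, rfl⟩ := hs
    obtain ⟨T, hT⟩ := σ.exists_holds_iff id default hφ
    exact ⟨T, fun σ' h => (hT σ' h).2 hσ⟩
  | univ => exact ⟨∅, fun _ _ => trivial⟩
  | inter s t _ _ ih₁ ih₂ =>
    obtain ⟨T₁, h₁⟩ := ih₁ hσ.1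
    obtain ⟨T₂, h₂⟩ := ih₂ hσ.2
    exact ⟨T₁ ∪ T₂, fun σ' h => ⟨h₁ σ' (h.mono Finset.subset_union_left),
      h₂ σ' (h.mono Finset.subset_union_right)⟩⟩
  | sUnion S _ ih =>
    obtain ⟨s, hs, hσs⟩ := hσ
    obtain ⟨T, hT⟩ := ih s hs hσs
    exact ⟨T, fun σ' h => ⟨s, hs, hT σ' h⟩⟩

variable [N ⊨ randomGraphTheory]

/-- Values of `f⁻¹` need not be recorded: those on `T` are determined by the values of `f` on the
preimage of `T` under `σ`. -/
theorem exists_extends_subset {U : Set (Exp N cycleFreeAutTheory)} (hU : IsOpen U)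
    {σ : Exp N cycleFreeAutTheory} (hσ : σ ∈ U) :
    ∃ T : Finset N, ∀ σ' : Exp N cycleFreeAutTheory,
      (∀ x ∈ T, (σ' : Expansion _ _ N).map x = (σ : Expansion _ _ N).map x) → σ' ∈ U := by
  classical
  obtain ⟨V, hV, rfl⟩ := isOpen_induced_iff.1 hU
  obtain ⟨T, hT⟩ := Expansion.exists_agreeOn_subset hV hσ
  obtain ⟨F, -, hF, hF'⟩ := exists_perm_of_mem_Exp σ.2
  refine ⟨T ∪ T.image F.symm, fun σ' h => hT _ fun x hx => ⟨h x (Finset.mem_union_left _ hx), ?_⟩⟩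
  obtain ⟨G, -, hG, hG'⟩ := exists_perm_of_mem_Exp σ'.2
  have := h _ (Finset.mem_union_right _ (Finset.mem_image_of_mem _ hx))
  rw [← hF, ← hG, F.apply_symm_apply] at this
  rw [← hF', ← hG', Equiv.symm_apply_eq, this]

/-- A finite condition defines a nonempty open set, which meets `U` by density; by openness a finite
part of a common point already forces membership in `U`. -/
theorem isCofinal_of_dense [Countable N] {U : Set (Exp N cycleFreeAutTheory)} (hU : IsOpen U)
    (hd : Dense U) :
    IsCofinal {q : PartialAut (fun x y : N => RelMap adj ![x, y]) |
      ∀ σ : Exp N cycleFreeAutTheory, Extends (σ : Expansion _ _ N).map q.1 → σ ∈ U} := by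
  classical
  intro p
  obtain ⟨G, hG, hGp, -⟩ := exists_perm_extends (model_randomGraphTheory_iff.1 inferInstance)
    (Empty.elim : Empty → _) p
  obtain ⟨σ, hσp, hσU⟩ := hd.inter_open_nonempty _
    ((isOpen_extends p.1).preimage continuous_subtype_val)
    ⟨⟨_, hG.ofPerm_mem_Exp⟩, hGp⟩
  obtain ⟨T, hT⟩ := exists_extends_subset hU hσU
  obtain ⟨F, hF, hFσ, -⟩ := exists_perm_of_mem_Exp σ.2
  refine ⟨⟨_, hF.isPartialAut (T ∪ p.1.image Prod.fst)⟩, fun σ' h => hT σ' fun x hx => ?_,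
    fun s hs => ?_⟩
  · rw [← hFσ]
    exact h (x, F x) (Finset.mem_image_of_mem _ (Finset.mem_union_left _ hx))
  · refine Finset.mem_image.2
      ⟨s.1, Finset.mem_union_right _ (Finset.mem_image_of_mem _ hs), ?_⟩
    rw [hFσ, hσp s hs]

theorem not_isTrussGeneric [Countable N] (τ : Exp N cycleFreeAutTheory) : ¬ IsTrussGeneric τ := by
  intro hτ
  have hR : IsRandomGraph (fun x y : N => RelMap adj ![x, y]) :=
    model_randomGraphTheory_iff.1 inferInstance
  obtain ⟨S, hSo, hSd, hSc, hS⟩ := mem_residual_iff.1 hτ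
  obtain ⟨H, hH, hHτ, -⟩ := exists_perm_of_mem_Exp τ.2
  have := hSc.to_subtype
  -- The requirements are the dense open sets witnessing comeagreness and, for each pair `(y, z)`,
  -- that the orbit of `z` under `F` has a different invariant from that of `y` under `H`.
  obtain ⟨F, hF, -, hFD⟩ := exists_perm_extends hR (ι := S ⊕ N × N)
    (Sum.elim (fun U => ⟨_, isCofinal_of_dense (hSo U.1 U.2) (hSd U.1 U.2)⟩)
      fun y => ⟨_, isCofinal_orbit_ne hR {n | RelMap adj ![(H ^ n) y.1, y.1]} y.2⟩)
    ⟨∅, IsPartialAut.empty⟩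
  obtain ⟨g, hg⟩ := hS (a := (⟨_, hF.ofPerm_mem_Exp⟩ : Exp N cycleFreeAutTheory)) (by
    intro U hU
    obtain ⟨q, hq, hFq⟩ := hFD (Sum.inl ⟨U, hU⟩)
    exact hq _ hFq)
  have hFH : ∀ x, F (g x) = g (H x) := fun x => by
    have h1 : F (g x) = ((τ : Expansion Language.graph autLanguage N).conj g).map (g x) := by
      rw [← hg]; rfl
    rw [h1, hHτ]
    let _ : autLanguage.Structure N := (τ : Expansion Language.graph autLanguage N)
    refine congrArg g (congrArg (funMap (L := autLanguage) AutFunctions.f) (funext fun j => ?_))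
    rw [Subsingleton.elim j 0]
    exact g.symm_apply_apply x
  have hpow : ∀ (n : ℕ) (x : N), (F ^ n) (g x) = g ((H ^ n) x) := by
    intro n
    induction n with
    | zero => intro x; rfl
    | succ n ih =>
      intro x
      rw [pow_succ', pow_succ', Equiv.Perm.mul_apply, Equiv.Perm.mul_apply, ih, hFH]
  obtain ⟨y, -⟩ := hR.exists_adj_iff ∅ fun _ => True
  -- The conjugating `g` is known only after `F`, which is why all pairs were treated in advance.
  -- Conjugation gives `g y` under `F` the invariant of `y` under `H`.
  obtain ⟨q, hq, hFq⟩ := hFD (Sum.inr (y, g y))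
  obtain ⟨n, hn⟩ := hq F hF hFq
  refine hn ?_
  rw [hpow]
  refine Iff.trans (iff_of_eq (congrArg _ (funext fun j => ?_)))
    (g.map_rel adj ![(H ^ n) y, y])
  fin_cases j <;> rfl

end Generic

theorem mainTheorem10 :
    (∃ Tmc : graphAutLanguage.Theory, IsModelCompanion cycleFreeAutTheory Tmc) ∧
      ∀ (N : Type*) [FirstOrder.Language.graph.Structure N] [Countable N] [N ⊨ randomGraphTheory],
        ¬ ∃ τ : Exp N cycleFreeAutTheory, IsTrussGeneric τ :=
  ⟨⟨genericAutTheory, isModelCompanion_genericAutTheory⟩,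
    fun _ _ _ _ ⟨τ, hτ⟩ => not_isTrussGeneric τ hτ⟩
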